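/- **Setting.** Work in $d$ spacetime dimensions with finitely many physical fields $\phi^i$ (each bosonic or fermionic) and finitely many gauge parameters. The quantum fields are $\Phi^\alpha=\{\phi^i,C^I,\bar C^I,B^I\}$ (ghosts and antighosts have statistics opposite to the one of the gauge parameters, the Lagrange multipliers $B^I$ have the same one), the background fields are $\underline\Phi^\alpha=\{\underline\phi^i,\underline C^I\}$, and $K_\alpha,\underline K_\alpha$ are the corresponding sources, of opposite statistics. Densities are formal power series in an expansion parameter whose coefficients are polynomials in the (anti)commuting fields, sources and finitely many of their derivatives, with coefficients in a field of characteristic $0$; a local functional is a density modulo total derivatives. With left/right functional derivatives $\delta_l,\delta_r$, the antiparentheses are $$\llbracket X,Y\rrbracket=\int\Big\{\frac{\delta_rX}{\delta\Phi^\alpha}\frac{\delta_lY}{\delta K_\alpha}+\frac{\delta_rX}{\delta\underline\Phi^\alpha}\frac{\delta_lY}{\delta\underline K_\alpha}-\frac{\delta_rX}{\delta K_\alpha}\frac{\delta_lY}{\delta\Phi^\alpha}-\frac{\delta_rX}{\delta\underline K_\alpha}\frac{\delta_lY}{\delta\underline\Phi^\alpha}\Big\}.$$ **Background action.** Let the gauge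 transformations be such that $R^i_\phi(\phi,C)$ is linear in $C$ and at most linear in $\phi$, $R^I_C(C)$ is quadratic in $C$, and let $\mathcal R^I_{\bar C}(\bar C,C)$ and $\mathcal R^I_B(B,C)$ be bilinear (all local, with the statistics of transformations of $\phi^i,C^I,\bar C^I,B^I$ with a ghost in place of the gauge parameter). For $\phi$ and $C$ set $\mathcal R^\alpha(\Phi,\underline C)=R^\alpha(\Phi+\underline\Phi)-R^\alpha(\underline\Phi)-R^\alpha(\phi+\underline\phi,C)$, and for $\bar C,B$ use the given $\mathcal R_{\bar C}(\bar C,\underline C)$, $\mathcal R_B(B,\underline C)$. Let $$\bar S=-\int\mathcal R^\alpha(\Phi,\underline C)K_\alpha-\int R^\alpha(\underline\Phi)\underline K_\alpha ,$$ and let $\hat S(\Phi,\underline\phi,K)$ be any bosonic local functional that is independent of $\underline K$ and $\underline C$. **Transformation.** Let $Q(\Phi,\underline\phi,K)$ be a fermionic local functional, independent of $\underline K$ and $\underline C$, with $\llbracket\bar S,Q\rrbracket=0$. Consider a canonical transformation $\Phi,\underline\Phi,K,\underline K\to\Phi',\underline\Phi',K',\underline K'$ (an invertible, perturbatively local change of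 variables) generated by $$F(\Phi,\underline\Phi,K',\underline K')=\int\Phi^\alpha K'_\alpha+\int\underline\Phi^\alpha\underline K'_\alpha+Q(\Phi,\underline\phi,K'),$$ that is, $\Phi'=\delta F/\delta K'$, $\underline\Phi'=\delta F/\delta\underline K'$, $K=\delta F/\delta\Phi$, $\underline K=\delta F/\delta\underline\Phi$, where $(\Phi,\underline\Phi,K',\underline K')$ is related to $(\Phi,\underline\Phi,K,\underline K)$ by an invertible, perturbatively local change of variables. Define the transformed functionals by $X'(\Phi',\underline\Phi',K',\underline K')=X(\Phi,\underline\Phi,K,\underline K)$. **Claim.** 1. If $\llbracket\hat S,\hat S\rrbracket=\llbracket\hat S,\bar S\rrbracket=\llbracket\bar S,\bar S\rrbracket=0$, then $\llbracket\hat S',\hat S'\rrbracket'=\llbracket\hat S',\bar S'\rrbracket'=\llbracket\bar S',\bar S'\rrbracket'=0$, where $\llbracket\cdot,\cdot\rrbracket'$ are the antiparentheses in the primed variables. 2. $\hat S'$ is independent of $\underline K'$ and $\underline C'$. 3. The background action is invariant: $\bar S'(\Phi,\underline\Phi,K,\underline K)=\bar S(\Phi,\underline\Phi,K,\underline K)$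 as local functionals. 4. The background fields and the sources of the background ghosts do not transform: $\underline\Phi'=\underline\Phi$, $\underline K'_C=\underline K_C$. -/

import Mathlib

namespace BV

open scoped BigOperators

noncomputable section

/-! ### Free supercommutative algebras -/

/-- The sign `(-1)^p` of a parity `p`. -/
def sgn (𝕜 : Type*) [Field 𝕜] (p : ZMod 2) : 𝕜 := if p = 0 then 1 else -1

lemma sgn_mul_self (𝕜 : Type*) [Field 𝕜] (p : ZMod 2) : sgn 𝕜 p * sgn 𝕜 p = 1 := by
  unfold sgn; split_ifs <;> simp

section SuperPoly

variable (𝕜 : Type*) [Field 𝕜] {J : Type*} (p : J → ZMod 2)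

/-- Supercommutation of the generators: `x y = (-1)^(|x||y|) y x`
(so that `x ^ 2 = 0` for odd `x` in characteristic zero). -/
inductive SuperRel : FreeAlgebra 𝕜 J → FreeAlgebra 𝕜 J → Prop
  | comm (x y : J) : SuperRel (FreeAlgebra.ι 𝕜 x * FreeAlgebra.ι 𝕜 y)
      (sgn 𝕜 (p x * p y) • (FreeAlgebra.ι 𝕜 y * FreeAlgebra.ι 𝕜 x))

/-- Polynomials in even (commuting) and odd (anticommuting) variables `x : J` of parity `p x`:
the free supercommutative algebra. -/
abbrev SuperPoly : Type _ := RingQuot (SuperRel 𝕜 p)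

/-- The variable `x`. -/
def gen (x : J) : SuperPoly 𝕜 p := RingQuot.mkAlgHom 𝕜 (SuperRel 𝕜 p) (FreeAlgebra.ι 𝕜 x)

lemma gen_comm (x y : J) :
    gen 𝕜 p x * gen 𝕜 p y = sgn 𝕜 (p x * p y) • (gen 𝕜 p y * gen 𝕜 p x) := by
  have h := RingQuot.mkAlgHom_rel 𝕜 (SuperRel.comm (𝕜 := 𝕜) (p := p) x y)
  simpa [gen] using h

/-- Algebra homomorphisms out of `SuperPoly` are given by supercommuting images of the variables. -/
def lift {A : Type*} [Ring A] [Algebra 𝕜 A] (f : J → A)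
    (hf : ∀ x y, f x * f y = sgn 𝕜 (p x * p y) • (f y * f x)) : SuperPoly 𝕜 p →ₐ[𝕜] A :=
  RingQuot.liftAlgHom 𝕜 ⟨FreeAlgebra.lift 𝕜 f, by
    rintro _ _ ⟨x, y⟩
    simpa using hf x y⟩

@[simp] lemma lift_gen {A : Type*} [Ring A] [Algebra 𝕜 A] (f : J → A)
    (hf : ∀ x y, f x * f y = sgn 𝕜 (p x * p y) • (f y * f x)) (x : J) :
    lift 𝕜 p f hf (gen 𝕜 p x) = f x := by
  simp [lift, gen]

/-- The parity automorphism `f ↦ (-1)^|f| f`. -/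
def parityHom : SuperPoly 𝕜 p →ₐ[𝕜] SuperPoly 𝕜 p :=
  lift 𝕜 p (fun x => sgn 𝕜 (p x) • gen 𝕜 p x) (by
    intro x y
    simp only [smul_mul_smul_comm, gen_comm 𝕜 p x y, smul_smul]
    congr 1
    ring)

open Classical in
/-- `f ↦ (±f, ∂f; 0, f)`, with `∂` the left derivative with respect to the variable `x`. -/
def leftDerivHom (x : J) : SuperPoly 𝕜 p →ₐ[𝕜] Matrix (Fin 2) (Fin 2) (SuperPoly 𝕜 p) :=
  lift 𝕜 p (fun y => !![sgn 𝕜 (p x * p y) • gen 𝕜 p y, if y = x then 1 else 0; 0, gen 𝕜 p y]) (by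
    intro y z
    have h := gen_comm 𝕜 p y z
    ext i j
    fin_cases i <;> fin_cases j
    · simp only [Matrix.mul_apply, Fin.sum_univ_two]
      simp only [Fin.zero_eta, Fin.isValue, Matrix.of_apply, Matrix.cons_val', Matrix.cons_val_zero,
        Matrix.cons_val_fin_one, Matrix.cons_val_one, mul_zero, add_zero, Matrix.smul_apply,
        Matrix.mul_apply, Fin.sum_univ_two, smul_mul_smul_comm, h, smul_smul]
      congr 1
      ring
    · by_cases hy : y = x <;> by_cases hz : z = x
      · subst hy; subst hz
        simp [Matrix.mul_apply, Fin.sum_univ_two, smul_smul, sgn_mul_self, add_comm]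
      · subst hy
        simp [Matrix.mul_apply, Fin.sum_univ_two, smul_smul, sgn_mul_self, hz]
      · subst hz
        simp [Matrix.mul_apply, Fin.sum_univ_two, hy, mul_comm]
      · simp [Matrix.mul_apply, Fin.sum_univ_two, hy, hz]
    · simp [Matrix.mul_apply, Fin.sum_univ_two]
    · by_cases hz : z = x <;> simpa [Matrix.mul_apply, Fin.sum_univ_two, hz] using h)

open Classical in
/-- `f ↦ (f, ∂f; 0, ±f)`, with `∂` the right derivative with respect to the variable `x`. -/
def rightDerivHom (x : J) : SuperPoly 𝕜 p →ₐ[𝕜] Matrix (Fin 2) (Fin 2) (SuperPoly 𝕜 p) :=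
  lift 𝕜 p (fun y => !![gen 𝕜 p y, if y = x then 1 else 0; 0, sgn 𝕜 (p x * p y) • gen 𝕜 p y]) (by
    intro y z
    have h := gen_comm 𝕜 p y z
    ext i j
    fin_cases i <;> fin_cases j
    · by_cases hz : z = x <;> simpa [Matrix.mul_apply, Fin.sum_univ_two, hz] using h
    · by_cases hy : y = x <;> by_cases hz : z = x
      · subst hy; subst hz
        simp [Matrix.mul_apply, Fin.sum_univ_two, smul_smul, sgn_mul_self, add_comm]
      · subst hy
        simp [Matrix.mul_apply, Fin.sum_univ_two, hz]
      · subst hz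
        simp [Matrix.mul_apply, Fin.sum_univ_two, smul_smul, hy, mul_comm, sgn_mul_self]
      · simp [Matrix.mul_apply, Fin.sum_univ_two, hy, hz]
    · simp [Matrix.mul_apply, Fin.sum_univ_two]
    · simp only [Matrix.mul_apply, Fin.sum_univ_two]
      simp only [Fin.mk_one, Fin.isValue, Matrix.of_apply, Matrix.cons_val', Matrix.cons_val_zero,
        Matrix.cons_val_fin_one, Matrix.cons_val_one, zero_mul, zero_add, Matrix.smul_apply,
        Matrix.mul_apply, Fin.sum_univ_two, smul_mul_smul_comm, h, smul_smul]
      congr 1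
      ring)

/-- The left partial derivative `∂_l f / ∂x`; it satisfies `∂_l (f g) = (∂_l f) g ± f (∂_l g)`
with the sign `(-1)^(|x||f|)`. -/
def leftDeriv (x : J) : SuperPoly 𝕜 p →ₗ[𝕜] SuperPoly 𝕜 p :=
  Matrix.entryLinearMap 𝕜 (SuperPoly 𝕜 p) 0 1 ∘ₗ (leftDerivHom 𝕜 p x).toLinearMap

/-- The right partial derivative `∂_r f / ∂x`; it satisfies `∂_r (f g) = f (∂_r g) ± (∂_r f) g`
with the sign `(-1)^(|x||g|)`. -/
def rightDeriv (x : J) : SuperPoly 𝕜 p →ₗ[𝕜] SuperPoly 𝕜 p :=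
  Matrix.entryLinearMap 𝕜 (SuperPoly 𝕜 p) 0 1 ∘ₗ (rightDerivHom 𝕜 p x).toLinearMap

end SuperPoly

/-! ### Fields, sources and jets -/

/-- The fields, with `ι` the index set of the physical fields and `G` the one of the gauge
parameters: the quantum fields `φⁱ, Cᴵ, C̄ᴵ, Bᴵ` and the background fields `φ̲ⁱ, C̲ᴵ`. -/
inductive Label (ι G : Type*)
  | phys (i : ι)
  | ghost (I : G)
  | antighost (I : G)
  | lagrange (I : G)
  | bgPhys (i : ι)
  | bgGhost (I : G)

/-- Each field comes with its source `K` (for background fields: the background source `K̲`). -/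
inductive Var (ι G : Type*)
  | field (a : Label ι G)
  | source (a : Label ι G)

section Fields

variable {ι G : Type*}

/-- The background fields (and, through them, the background sources). -/
def Label.IsBackground : Label ι G → Prop
  | .bgPhys _ => True
  | .bgGhost _ => True
  | _ => False

/-- Sum over all fields. -/
def sumLabels [Fintype ι] [Fintype G] {A : Type*} [AddCommMonoid A] (f : Label ι G → A) : A :=
  ∑ i, (f (.phys i) + f (.bgPhys i)) +
    ∑ I, (f (.ghost I) + f (.antighost I) + f (.lagrange I) + f (.bgGhost I))

variable (ε : ι → ZMod 2) (η : G → ZMod 2)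

/-- Statistics of the fields: `ε i` is the one of `φⁱ`, `η I` is the one of the `I`th gauge
parameter; (anti)ghosts have the opposite one. -/
def Label.parity : Label ι G → ZMod 2
  | .phys i => ε i
  | .ghost I => η I + 1
  | .antighost I => η I + 1
  | .lagrange I => η I
  | .bgPhys i => ε i
  | .bgGhost I => η I + 1

/-- A source has the statistics opposite to the one of its field. -/
def Var.parity : Var ι G → ZMod 2
  | .field a => a.parity ε η
  | .source a => a.parity ε η + 1

end Fields

section Densities

variable {ι G : Type*} (𝕜 : Type*) [Field 𝕜] (d : ℕ) (ε : ι → ZMod 2) (η : G → ZMod 2)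

/-- Polynomials in the fields, the sources and their spacetime derivatives, in `d` dimensions.
The variable `(v, m)` is the derivative `∂^m v` with multi-index `m`. -/
abbrev JetPoly : Type _ :=
  SuperPoly 𝕜 (fun j : Var ι G × (Fin d → ℕ) => j.1.parity ε η)

/-- Perturbatively local densities: formal power series in the expansion parameter
(`PowerSeries.X`), whose coefficients are polynomials in the fields, the sources and finitely many
of their derivatives. -/
abbrev Density : Type _ := PowerSeries (JetPoly 𝕜 d ε η)

/-- `∂_μ` on polynomials in jets, inside `f ↦ (f, ∂_μ f; 0, f)`. -/
def jetTotalDerivHom (μ : Fin d) :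
    JetPoly 𝕜 d ε η →ₐ[𝕜] Matrix (Fin 2) (Fin 2) (JetPoly 𝕜 d ε η) :=
  lift 𝕜 _ (fun j => !![gen 𝕜 _ j, gen 𝕜 _ (j.1, j.2 + Pi.single μ 1); 0, gen 𝕜 _ j]) (by
    intro y z
    have h := gen_comm 𝕜 (fun j : Var ι G × (Fin d → ℕ) => j.1.parity ε η)
    ext i j
    fin_cases i <;> fin_cases j
    · simpa [Matrix.mul_apply, Fin.sum_univ_two] using h y z
    · simp [Matrix.mul_apply, Fin.sum_univ_two, h y, h (y.1, _) z, add_comm]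
    · simp [Matrix.mul_apply, Fin.sum_univ_two]
    · simpa [Matrix.mul_apply, Fin.sum_univ_two] using h y z)

/-- The spacetime (total) derivative `∂_μ` on polynomials in jets: the derivation that sends
`∂^m v` to `∂_μ ∂^m v`. -/
def jetTotalDeriv (μ : Fin d) : JetPoly 𝕜 d ε η →ₗ[𝕜] JetPoly 𝕜 d ε η :=
  Matrix.entryLinearMap 𝕜 (JetPoly 𝕜 d ε η) 0 1 ∘ₗ (jetTotalDerivHom 𝕜 d ε η μ).toLinearMap

/-- `∂^m` for a multi-index `m` (the `∂_μ` commute). -/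
def jetTotalDerivs (m : Fin d → ℕ) : Module.End 𝕜 (JetPoly 𝕜 d ε η) :=
  ((List.finRange d).map fun μ => (jetTotalDeriv 𝕜 d ε η μ : Module.End 𝕜 _) ^ m μ).prod

variable {𝕜 d ε η}

/-- Linear maps act on densities order by order in the expansion parameter. -/
def mapCoeff (L : JetPoly 𝕜 d ε η →ₗ[𝕜] JetPoly 𝕜 d ε η) : Density 𝕜 d ε η →ₗ[𝕜] Density 𝕜 d ε η where
  toFun f := PowerSeries.mk fun n => L (PowerSeries.coeff n f)
  map_add' f g := by ext n; simp
  map_smul' c f := by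
    ext n
    simp

/-- The spacetime derivative `∂_μ` of a density. -/
def totalDeriv (μ : Fin d) : Density 𝕜 d ε η →ₗ[𝕜] Density 𝕜 d ε η :=
  mapCoeff (jetTotalDeriv 𝕜 d ε η μ)

/-- The parity map `f ↦ (-1)^|f| f` on densities. -/
def parityMap : Density 𝕜 d ε η →ₗ[𝕜] Density 𝕜 d ε η :=
  mapCoeff (parityHom 𝕜 fun j : Var ι G × (Fin d → ℕ) => j.1.parity ε η).toLinearMap

/-- `f` is homogeneous of parity `q`. -/
def HasParity (q : ZMod 2) (f : Density 𝕜 d ε η) : Prop := parityMap f = sgn 𝕜 q • f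

/-- A variable `v`, as a density. -/
def var (v : Var ι G) : Density 𝕜 d ε η := PowerSeries.C (gen 𝕜 _ (v, 0))

/-- A field `Φ^a` or `Φ̲^a`. -/
abbrev fld (a : Label ι G) : Density 𝕜 d ε η := var (.field a)

/-- A source `K_a` or `K̲_a`. -/
abbrev src (a : Label ι G) : Density 𝕜 d ε η := var (.source a)

variable (𝕜 d ε η) in
/-- Linear combinations of total derivatives. -/
def totalDerivatives : Submodule 𝕜 (Density 𝕜 d ε η) :=
  ⨆ μ, LinearMap.range (totalDeriv (𝕜 := 𝕜) (ε := ε) (η := η) μ)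

variable (𝕜 d ε η) in
/-- Local functionals: densities up to total derivatives. -/
abbrev LocalFunctional : Type _ := Density 𝕜 d ε η ⧸ totalDerivatives 𝕜 d ε η

/-- The local functional `∫ f` of a density `f`. -/
def integral : Density 𝕜 d ε η →ₗ[𝕜] LocalFunctional 𝕜 d ε η := (totalDerivatives 𝕜 d ε η).mkQ

/-- The left functional derivative `δ_l (∫ f) / δv = ∑_m (-∂)^m (∂_l f / ∂(∂^m v))`. The sum is
finite, order by order in the expansion parameter. -/
def leftFun (v : Var ι G) (f : Density 𝕜 d ε η) : Density 𝕜 d ε η :=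
  PowerSeries.mk fun n => ∑ᶠ m : Fin d → ℕ, (-1 : 𝕜) ^ (∑ μ, m μ) •
    jetTotalDerivs 𝕜 d ε η m (leftDeriv 𝕜 _ (v, m) (PowerSeries.coeff n f))

/-- The right functional derivative `δ_r (∫ f) / δv = ∑_m (-∂)^m (∂_r f / ∂(∂^m v))`. -/
def rightFun (v : Var ι G) (f : Density 𝕜 d ε η) : Density 𝕜 d ε η :=
  PowerSeries.mk fun n => ∑ᶠ m : Fin d → ℕ, (-1 : 𝕜) ^ (∑ μ, m μ) •
    jetTotalDerivs 𝕜 d ε η m (rightDeriv 𝕜 _ (v, m) (PowerSeries.coeff n f))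

/-- The antiparentheses `⟦∫ f, ∫ g⟧`, summed over quantum and background pairs. -/
def antibracket [Fintype ι] [Fintype G] (f g : Density 𝕜 d ε η) : LocalFunctional 𝕜 d ε η :=
  integral (sumLabels fun a =>
    rightFun (.field a) f * leftFun (.source a) g - rightFun (.source a) f * leftFun (.field a) g)

/-- The variables `Φ, φ̲, K`, i.e. all but the background ghosts `C̲` and the background
sources `K̲`. -/
def Var.IsQuantum : Var ι G → Prop
  | .field (.bgGhost _) => False
  | .field _ => True
  | .source a => ¬ a.IsBackground

/-- The local functional `∫ f` is a functional of `Φ, φ̲, K` only, i.e. it is independent of `C̲`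
and `K̲`: it has a density that does not contain these variables. -/
def IndependentOfBgGhostsAndSources (f : Density 𝕜 d ε η) : Prop :=
  ∃ g : Density 𝕜 d ε η, integral f = integral g ∧
    ∀ n, PowerSeries.coeff n g ∈
      Algebra.adjoin 𝕜 {x : JetPoly 𝕜 d ε η | ∃ (v : Var ι G) (m : Fin d → ℕ),
        v.IsQuantum ∧ x = gen 𝕜 _ (v, m)}

/-! ### Canonical transformations -/

/-- An invertible, perturbatively local change of variables `z ↦ z'(z)`, viewed as the map `T` that
expresses functions of the primed variables in the unprimed ones: `(T f)(z) = f(z'(z))`. It is an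
automorphism that fixes the expansion parameter (hence acts by substitution, also in infinite
series), commutes with spacetime derivatives and preserves the statistics. -/
structure IsChangeOfVariables (T : Density 𝕜 d ε η ≃ₐ[𝕜] Density 𝕜 d ε η) : Prop where
  map_param : T PowerSeries.X = PowerSeries.X
  map_totalDeriv : ∀ μ f, T (totalDeriv μ f) = totalDeriv μ (T f)
  map_parity : ∀ f, T (parityMap f) = parityMap (T f)

/-- The change of variables `T` from `Φ, K` to `Φ', K'` is the canonical transformation generated
by the (odd) functional `∫ F(Φ, K')`, that is to say `Φ' = δF/δK'` and `K = δF/δΦ`, where `Φ, K`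
stand here for all fields and sources, including the background ones. The change of variables `M`
expresses functions of `Φ, K'` in the variables `Φ, K`. -/
def IsGeneratedBy (F : Density 𝕜 d ε η) (T : Density 𝕜 d ε η ≃ₐ[𝕜] Density 𝕜 d ε η) : Prop :=
  IsChangeOfVariables T ∧
    ∃ M : Density 𝕜 d ε η ≃ₐ[𝕜] Density 𝕜 d ε η, IsChangeOfVariables M ∧
      (∀ a, M (fld a) = fld a) ∧ (∀ a, M (src a) = T (src a)) ∧
      (∀ a, T (fld a) = M (leftFun (.source a) F)) ∧
      (∀ a, src a = M (leftFun (.field a) F))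

/-- The generating functional `∫ ΦK' + ∫ Φ̲K̲' + Q(Φ, φ̲, K')`. -/
def generating [Fintype ι] [Fintype G] (Q : Density 𝕜 d ε η) : Density 𝕜 d ε η :=
  sumLabels (fun a => fld a * src a) + Q

end Densities

/-! ### Gauge transformations and the background action -/

section Gauge

variable {ι G : Type*} {𝕜 : Type*} [Field 𝕜] {d : ℕ} {ε : ι → ZMod 2} {η : G → ZMod 2}

/-- The linear substitution `v ↦ ∑ w ∈ s v, w` in polynomials in jets. -/
def jetSubst (s : Var ι G → List (Var ι G))
    (hs : ∀ v, ∀ w ∈ s v, w.parity ε η = v.parity ε η) :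
    JetPoly 𝕜 d ε η →ₐ[𝕜] JetPoly 𝕜 d ε η :=
  lift 𝕜 _ (fun j => ((s j.1).map fun w => gen 𝕜 _ (w, j.2)).sum) (by
    intro x y
    have key : ∀ l l' : List (Var ι G), (∀ w ∈ l, w.parity ε η = x.1.parity ε η) →
        (∀ w ∈ l', w.parity ε η = y.1.parity ε η) →
        (l.map fun w => (gen 𝕜 _ (w, x.2) : JetPoly 𝕜 d ε η)).sum *
          (l'.map fun w => gen 𝕜 _ (w, y.2)).sum =
        sgn 𝕜 (x.1.parity ε η * y.1.parity ε η) •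
          ((l'.map fun w => gen 𝕜 _ (w, y.2)).sum * (l.map fun w => gen 𝕜 _ (w, x.2)).sum) := by
      intro l l' hl hl'
      induction l with
      | nil => simp
      | cons a l ih =>
        simp only [List.map_cons, List.sum_cons, add_mul, mul_add, smul_add]
        rw [ih fun w hw => hl w (List.mem_cons_of_mem _ hw)]
        congr 1
        have ha := hl a List.mem_cons_self
        clear ih hl
        induction l' with
        | nil => simp
        | cons b l' ih' =>
          simp only [List.map_cons, List.sum_cons, add_mul, mul_add, smul_add]
          rw [ih' fun w hw => hl' w (List.mem_cons_of_mem _ hw), gen_comm, ha,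
            hl' b List.mem_cons_self]
    exact key _ _ (hs x.1) (hs y.1))

/-- `φ ↦ φ + φ̲, C ↦ C + C̲`: it turns `R(Φ)` into `R(Φ + Φ̲)`. -/
def shiftAll : Density 𝕜 d ε η →ₗ[𝕜] Density 𝕜 d ε η :=
  mapCoeff (jetSubst (fun
    | .field (.phys i) => [.field (.phys i), .field (.bgPhys i)]
    | .field (.ghost I) => [.field (.ghost I), .field (.bgGhost I)]
    | v => [v]) (by
      rintro ((_ | _ | _ | _ | _ | _) | _) w hw <;>
        simp only [List.mem_cons, List.not_mem_nil, or_false] at hw <;>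
        rcases hw with rfl | rfl <;> rfl)).toLinearMap

/-- `φ ↦ φ + φ̲`: it turns `R(Φ)` into `R(φ + φ̲, C, C̄, B)`. -/
def shiftPhys : Density 𝕜 d ε η →ₗ[𝕜] Density 𝕜 d ε η :=
  mapCoeff (jetSubst (fun
    | .field (.phys i) => [.field (.phys i), .field (.bgPhys i)]
    | v => [v]) (by
      rintro ((_ | _ | _ | _ | _ | _) | _) w hw <;>
        simp only [List.mem_cons, List.not_mem_nil, or_false] at hw <;>
        rcases hw with rfl | rfl <;> rfl)).toLinearMap

/-- `φ ↦ φ̲, C ↦ C̲`: it turns `R(Φ)` into `R(Φ̲)`. -/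
def toBackground : Density 𝕜 d ε η →ₗ[𝕜] Density 𝕜 d ε η :=
  mapCoeff (jetSubst (fun
    | .field (.phys i) => [.field (.bgPhys i)]
    | .field (.ghost I) => [.field (.bgGhost I)]
    | v => [v]) (by
      rintro ((_ | _ | _ | _ | _ | _) | _) w hw <;>
        simp only [List.mem_cons, List.not_mem_nil, or_false] at hw <;>
        (subst hw; rfl))).toLinearMap

/-- `C ↦ C̲`. -/
def ghostToBackground : Density 𝕜 d ε η →ₗ[𝕜] Density 𝕜 d ε η :=
  mapCoeff (jetSubst (fun
    | .field (.ghost I) => [.field (.bgGhost I)]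
    | v => [v]) (by
      rintro ((_ | _ | _ | _ | _ | _) | _) w hw <;>
        simp only [List.mem_cons, List.not_mem_nil, or_false] at hw <;>
        (subst hw; rfl))).toLinearMap

variable (𝕜 d ε η) in
/-- Linear combinations of `∂^m C^I`. -/
def linearInGhosts : Submodule 𝕜 (JetPoly 𝕜 d ε η) :=
  Submodule.span 𝕜 {x | ∃ (I : G) (m : Fin d → ℕ), x = gen 𝕜 _ (.field (.ghost I), m)}

variable (𝕜 d ε) in
/-- Linear combinations of `(∂^m A)(∂^n C^I)`, where `A` is one of the fields in the range
of `s`. -/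
def bilinearWithGhosts {σ : Type*} (s : σ → Label ι G) : Submodule 𝕜 (JetPoly 𝕜 d ε η) :=
  Submodule.span 𝕜 {x | ∃ (A : σ) (m : Fin d → ℕ) (I : G) (n : Fin d → ℕ),
    x = gen 𝕜 _ (.field (s A), m) * gen 𝕜 _ (.field (.ghost I), n)}

variable (𝕜 d ε η) in
/-- The infinitesimal gauge transformations in the space of fields, for an irreducible algebra and
under the linearity assumption:
* `Rphys i` is `R_φ^i(φ, C)`, linear in the ghosts and at most linear in the physical fields;
* `Rghost I` is `R_C^I(C)`, quadratic in the ghosts (field-independent closure);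
* `Rantighost I` and `Rlagrange I` are the bilinear forms `ℛ_C̄^I(C̄, C)` and `ℛ_B^I(B, C)`
  by which antighosts and Lagrange multipliers would transform if they were matter fields. -/
structure GaugeTransformations where
  Rphys : ι → Density 𝕜 d ε η
  Rghost : G → Density 𝕜 d ε η
  Rantighost : G → Density 𝕜 d ε η
  Rlagrange : G → Density 𝕜 d ε η
  Rphys_mem : ∀ i n, PowerSeries.coeff n (Rphys i) ∈
    linearInGhosts 𝕜 d ε η ⊔ bilinearWithGhosts 𝕜 d ε (fun j : ι => .phys j)
  Rghost_mem : ∀ I n, PowerSeries.coeff n (Rghost I) ∈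
    bilinearWithGhosts 𝕜 d ε (fun J : G => .ghost J)
  Rantighost_mem : ∀ I n, PowerSeries.coeff n (Rantighost I) ∈
    bilinearWithGhosts 𝕜 d ε (fun J : G => .antighost J)
  Rlagrange_mem : ∀ I n, PowerSeries.coeff n (Rlagrange I) ∈
    bilinearWithGhosts 𝕜 d ε (fun J : G => .lagrange J)
  Rphys_parity : ∀ i, HasParity (ε i + 1) (Rphys i)
  Rghost_parity : ∀ I, HasParity (η I) (Rghost I)
  Rantighost_parity : ∀ I, HasParity (η I) (Rantighost I)
  Rlagrange_parity : ∀ I, HasParity (η I + 1) (Rlagrange I)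

/-- `R(Φ + Φ̲) - R(Φ̲) - R(φ + φ̲, C, C̄, B)`. -/
def matterPart (R : Density 𝕜 d ε η) : Density 𝕜 d ε η :=
  shiftAll R - toBackground R - shiftPhys R

/-- The background transformations of the fields: `ℛ^α(Φ, C̲)` for the quantum fields (where
`ℛ^α = R^α(Φ + Φ̲) - R^α(Φ̲) - R^α(φ + φ̲, C, C̄, B)` for `φ` and `C`), and `R^α(Φ̲)` for the
background fields. -/
def GaugeTransformations.background (R : GaugeTransformations 𝕜 d ε η) :
    Label ι G → Density 𝕜 d ε η
  | .phys i => matterPart (R.Rphys i)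
  | .ghost I => matterPart (R.Rghost I)
  | .antighost I => ghostToBackground (R.Rantighost I)
  | .lagrange I => ghostToBackground (R.Rlagrange I)
  | .bgPhys i => toBackground (R.Rphys i)
  | .bgGhost I => toBackground (R.Rghost I)

/-- The background action `S̄ = -∫ ℛ^α(Φ, C̲) K_α - ∫ R^α(Φ̲) K̲_α`. -/
def backgroundAction [Fintype ι] [Fintype G] (R : GaugeTransformations 𝕜 d ε η) :
    Density 𝕜 d ε η :=
  -sumLabels fun a => R.background a * src a

/-- The background field master equations `⟦Ŝ, Ŝ⟧ = ⟦Ŝ, S̄⟧ = ⟦S̄, S̄⟧ = 0`. -/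
def MasterEquations [Fintype ι] [Fintype G] (Shat Sbar : Density 𝕜 d ε η) : Prop :=
  antibracket Shat Shat = 0 ∧ antibracket Shat Sbar = 0 ∧ antibracket Sbar Sbar = 0

end Gauge

end

end BV

namespace BV

open scoped BigOperators

noncomputable section

/-! ### Signs indexed by parities -/

section Signs

variable {𝕜 : Type*} [Field 𝕜]

/-! Everything is pulled back to the mixed variables (Φ, K'). There a function of the old variables
becomes `N f` and a function of the new ones `P f'`, with P = N ∘ T, so that f' = T⁻¹ f means N f =
P f'. The point of the mixed variables is that both maps are explicit (`IsMixed`): N fixes all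
fields and shifts every source by δQ/δΦ, while P fixes all sources and shifts every field by δQ/δK'.
No inverse ever has to be computed as a series.

Master equations. To even functionals f, g, together with their transforms f', g', one attaches odd
evolutionary vector fields D, D' on the mixed space. D moves Φ by ±N(δf/δK) and K' by ±P(δf'/δΦ'),
and D' does the same with g, g'. Expanding D(N g) = D(P g') and D'(N f) = D'(P f') by the chain rule
and adding gives N⟦f,g⟧ − P⟦f',g'⟧, plus mixed terms that cancel in pairs, plus second variations of
Q. The latter cancel because second variations are symmetric (`integral_second_variation`, obtained
from the anticommutator of D and D'). Hence brackets of even functionals correspond under N and P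
(`IsMixed.integral_bracketDensity`), and in particular vanish together.

Independence. T⁻¹ = P⁻¹ N. The shifts in N and P involve only Φ, φ̲, K, so N preserves functions of
these variables. So does P⁻¹, by a retraction argument that needs no formula for the inverse
(`IsChangeOfVariables.inVars_symm`).

Background action. S̄ is linear in the sources, and each monomial of the background transformations
contains a background field and at most one other field. Since Q has no K̲, P does not shift
background fields. Therefore the expansions of P S̄ and N S̄ around S̄ stop exactly at first order,
and their difference integrates to ⟦S̄, Q⟧ = 0 (`integral_backgroundAction`). Cancelling N leaves T
S̄ = S̄ modulo total derivatives.

The variables said not to transform are those whose shift vanishes because Q contains neither K̲ nor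
C̲.

All of this rests on the first variation formula (`IsEvolutionary.integral_eq`), which is
integration by parts. Infinite series in the expansion parameter are handled by linearity over X,
which determines a map by its values on polynomials. -/

lemma zmod2_cases (s : ZMod 2) : s = 0 ∨ s = 1 := by
  fin_cases s
  · exact Or.inl rfl
  · exact Or.inr rfl

@[simp] lemma sgn_zero : sgn 𝕜 0 = 1 := by simp [sgn]

@[simp] lemma sgn_one : sgn 𝕜 1 = -1 := by simp [sgn]

lemma zmod2_add_self (s : ZMod 2) : s + s = 0 := CharTwo.add_self_eq_zero s

lemma zmod2_mul_self (s : ZMod 2) : s * s = s := by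
  rcases zmod2_cases s with rfl | rfl <;> simp

lemma sgn_add (s t : ZMod 2) : sgn 𝕜 (s + t) = sgn 𝕜 s * sgn 𝕜 t := by
  rcases zmod2_cases s with rfl | rfl <;> rcases zmod2_cases t with rfl | rfl <;>
    simp [zmod2_add_self]

end Signs

/-! ### Superderivations of the free supercommutative algebra -/

section SuperPoly

variable {𝕜 : Type*} [Field 𝕜] {J : Type*} {p : J → ZMod 2}

theorem SuperPoly.induction {P : SuperPoly 𝕜 p → Prop} (h0 : ∀ c, P (algebraMap 𝕜 _ c))
    (h1 : ∀ x, P (gen 𝕜 p x)) (hadd : ∀ f g, P f → P g → P (f + g))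
    (hmul : ∀ f g, P f → P g → P (f * g)) (f : SuperPoly 𝕜 p) : P f := by
  obtain ⟨f, rfl⟩ := RingQuot.mkAlgHom_surjective 𝕜 (SuperRel 𝕜 p) f
  induction f using FreeAlgebra.induction with
  | grade0 c => simpa using h0 c
  | grade1 x => exact h1 x
  | mul a b ha hb => rw [map_mul]; exact hmul _ _ ha hb
  | add a b ha hb => rw [map_add]; exact hadd _ _ ha hb

/-- The automorphism `f ↦ (-1)^(s|f|) f`. -/
def twist (s : ZMod 2) : SuperPoly 𝕜 p →ₐ[𝕜] SuperPoly 𝕜 p :=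
  lift 𝕜 p (fun x => sgn 𝕜 (s * p x) • gen 𝕜 p x) (by
    intro x y
    simp only [smul_mul_smul_comm, gen_comm 𝕜 p x y, smul_smul]
    congr 1
    ring)

@[simp] lemma twist_gen (s : ZMod 2) (x : J) :
    twist s (gen 𝕜 p x) = sgn 𝕜 (s * p x) • gen 𝕜 p x := lift_gen ..

lemma twist_zero (f : SuperPoly 𝕜 p) : twist 0 f = f := by
  induction f using SuperPoly.induction <;> simp_all

lemma parityHom_eq_twist (f : SuperPoly 𝕜 p) : parityHom 𝕜 p f = twist 1 f := by
  induction f using SuperPoly.induction <;> simp_all [parityHom]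

lemma twist_twist (s t : ZMod 2) (f : SuperPoly 𝕜 p) : twist s (twist t f) = twist (s + t) f := by
  induction f using SuperPoly.induction with
  | h1 y => simp [add_mul, sgn_add, smul_smul, mul_comm (sgn 𝕜 (t * p y))]
  | _ => simp_all

lemma twist_of_parity {q : ZMod 2} {f : SuperPoly 𝕜 p} (hf : twist 1 f = sgn 𝕜 q • f)
    (s : ZMod 2) : twist s f = sgn 𝕜 (s * q) • f := by
  rcases zmod2_cases s with rfl | rfl
  · simp [twist_zero]
  · simpa using hf

lemma gen_mul_eq (x : J) (f : SuperPoly 𝕜 p) :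
    gen 𝕜 p x * f = twist (p x) f * gen 𝕜 p x := by
  induction f using SuperPoly.induction with
  | h0 c => simp [Algebra.commutes]
  | h1 y => simp [gen_comm 𝕜 p x y]
  | hadd f g hf hg => simp [mul_add, add_mul, hf, hg]
  | hmul f g hf hg => rw [← mul_assoc, hf, mul_assoc, hg, map_mul, mul_assoc]

/-- Writing the exchange sign as an automorphism of the other factor lets `f` be inhomogeneous, so
signs can be handled without decomposing polynomials by parity. -/
lemma mul_eq_twist_mul {q : ZMod 2} {w : SuperPoly 𝕜 p} (hw : twist 1 w = sgn 𝕜 q • w)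
    (f : SuperPoly 𝕜 p) : w * f = twist q f * w := by
  induction f using SuperPoly.induction with
  | h0 c => simp [Algebra.commutes]
  | h1 y =>
    simp [gen_mul_eq y w, twist_of_parity hw, smul_smul, mul_comm (p y) q, sgn_mul_self]
  | hadd f g hf hg => simp [mul_add, add_mul, hf, hg]
  | hmul f g hf hg => rw [← mul_assoc, hf, mul_assoc, hg, map_mul, mul_assoc]

/-- Once the diagonal entries are known, the graded Leibniz rule is the off-diagonal entry of a
product of two upper triangular matrices. -/
lemma leftDerivHom_eq (x : J) (f : SuperPoly 𝕜 p) :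
    leftDerivHom 𝕜 p x f = !![twist (p x) f, leftDeriv 𝕜 p x f; 0, f] := by
  have h : leftDerivHom 𝕜 p x f 0 0 = twist (p x) f ∧ leftDerivHom 𝕜 p x f 1 0 = 0 ∧
      leftDerivHom 𝕜 p x f 1 1 = f := by
    induction f using SuperPoly.induction with
    | h0 c => simp [Matrix.algebraMap_matrix_apply]
    | h1 y => simp [leftDerivHom]
    | hadd f g hf hg => simp [hf, hg]
    | hmul f g hf hg => simp [hf, hg, Matrix.mul_apply]
  ext i j
  fin_cases i <;> fin_cases j
  · exact h.1
  · rfl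
  · exact h.2.1
  · exact h.2.2

lemma leftDeriv_mul (x : J) (f g : SuperPoly 𝕜 p) : leftDeriv 𝕜 p x (f * g) =
    leftDeriv 𝕜 p x f * g + twist (p x) f * leftDeriv 𝕜 p x g := by
  have h : leftDeriv 𝕜 p x (f * g) = leftDerivHom 𝕜 p x (f * g) 0 1 := rfl
  rw [h, map_mul, leftDerivHom_eq, leftDerivHom_eq]
  simp [Matrix.mul_apply, add_comm]

@[simp] lemma leftDeriv_algebraMap (x : J) (c : 𝕜) :
    leftDeriv 𝕜 p x (algebraMap 𝕜 _ c) = 0 := by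
  simp [leftDeriv, Matrix.algebraMap_matrix_apply]

open Classical in
@[simp] lemma leftDeriv_gen (x y : J) :
    leftDeriv 𝕜 p x (gen 𝕜 p y) = if y = x then 1 else 0 := by
  simp [leftDeriv, leftDerivHom]

lemma rightDerivHom_eq (x : J) (f : SuperPoly 𝕜 p) :
    rightDerivHom 𝕜 p x f = !![f, rightDeriv 𝕜 p x f; 0, twist (p x) f] := by
  have h : rightDerivHom 𝕜 p x f 0 0 = f ∧ rightDerivHom 𝕜 p x f 1 0 = 0 ∧
      rightDerivHom 𝕜 p x f 1 1 = twist (p x) f := by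
    induction f using SuperPoly.induction with
    | h0 c => simp [Matrix.algebraMap_matrix_apply]
    | h1 y => simp [rightDerivHom]
    | hadd f g hf hg => simp [hf, hg]
    | hmul f g hf hg => simp [hf, hg, Matrix.mul_apply]
  ext i j
  fin_cases i <;> fin_cases j
  · exact h.1
  · rfl
  · exact h.2.1
  · exact h.2.2

lemma rightDeriv_mul (x : J) (f g : SuperPoly 𝕜 p) : rightDeriv 𝕜 p x (f * g) =
    rightDeriv 𝕜 p x f * twist (p x) g + f * rightDeriv 𝕜 p x g := by
  have h : rightDeriv 𝕜 p x (f * g) = rightDerivHom 𝕜 p x (f * g) 0 1 := rfl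
  rw [h, map_mul, rightDerivHom_eq, rightDerivHom_eq]
  simp [Matrix.mul_apply, add_comm]

/-- Moving the derivative to the other side costs (-1)^(|x|(|f|+1)). From here on only left
derivatives are needed. -/
lemma rightDeriv_eq (x : J) (f : SuperPoly 𝕜 p) :
    rightDeriv 𝕜 p x f = sgn 𝕜 (p x) • leftDeriv 𝕜 p x (twist (p x) f) := by
  induction f using SuperPoly.induction with
  | h0 c => simp [rightDeriv, Matrix.algebraMap_matrix_apply]
  | h1 y =>
    have h : rightDeriv 𝕜 p x (gen 𝕜 p y) = leftDeriv 𝕜 p x (gen 𝕜 p y) := by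
      simp [rightDeriv, rightDerivHom]
    rw [h, twist_gen, map_smul, smul_smul, leftDeriv_gen]
    split_ifs with h
    · subst h
      simp [zmod2_mul_self, sgn_mul_self]
    · simp
  | hadd f g hf hg => simp [hf, hg]
  | hmul f g hf hg =>
    rw [rightDeriv_mul, hf, hg, map_mul, leftDeriv_mul, twist_twist, zmod2_add_self, twist_zero,
      smul_add, smul_mul_assoc, mul_smul_comm]

lemma leftDeriv_twist (x : J) (s : ZMod 2) (f : SuperPoly 𝕜 p) :
    leftDeriv 𝕜 p x (twist s f) = sgn 𝕜 (s * p x) • twist s (leftDeriv 𝕜 p x f) := by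
  induction f using SuperPoly.induction with
  | h0 c => simp
  | h1 y =>
    simp only [twist_gen, map_smul, leftDeriv_gen]
    split_ifs with h
    · subst h; simp
    · simp
  | hadd f g hf hg => simp [hf, hg]
  | hmul f g hf hg =>
    simp only [map_mul, leftDeriv_mul, hf, hg, map_add, smul_add, twist_twist, smul_mul_assoc,
      mul_smul_comm, add_comm s]

/-- A polynomial involves finitely many variables. This makes every `∑ᶠ` over multi-indices a
genuine sum rather than the default value 0. -/
lemma finite_leftDeriv (f : SuperPoly 𝕜 p) : {x | leftDeriv 𝕜 p x f ≠ 0}.Finite := by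
  induction f using SuperPoly.induction with
  | h0 c => simp
  | h1 y =>
    refine (Set.finite_singleton y).subset fun x hx => ?_
    by_contra h
    simp_all [eq_comm]
  | hadd f g hf hg =>
    refine (hf.union hg).subset fun x hx => ?_
    by_contra h
    simp_all
  | hmul f g hf hg =>
    refine (hf.union hg).subset fun x hx => ?_
    by_contra h
    simp_all [leftDeriv_mul]

lemma leftDeriv_eq_zero_of_mem_adjoin {S : Set J} {x : J} (hx : x ∉ S) {f : SuperPoly 𝕜 p}
    (hf : f ∈ Algebra.adjoin 𝕜 (gen 𝕜 p '' S)) : leftDeriv 𝕜 p x f = 0 := by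
  induction hf using Algebra.adjoin_induction with
  | mem f h =>
    obtain ⟨y, hy, rfl⟩ := h
    rw [leftDeriv_gen, if_neg]
    rintro rfl
    exact hx hy
  | algebraMap c => simp
  | add f g _ _ hf hg => simp [hf, hg]
  | mul f g _ _ hf hg => simp [hf, hg, leftDeriv_mul]

lemma twist_mem_adjoin {S : Set J} (s : ZMod 2) {f : SuperPoly 𝕜 p}
    (hf : f ∈ Algebra.adjoin 𝕜 (gen 𝕜 p '' S)) :
    twist s f ∈ Algebra.adjoin 𝕜 (gen 𝕜 p '' S) := by
  induction hf using Algebra.adjoin_induction with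
  | mem f h =>
    obtain ⟨y, hy, rfl⟩ := h
    rw [twist_gen]
    exact Subalgebra.smul_mem _ (Algebra.subset_adjoin (Set.mem_image_of_mem _ hy)) _
  | algebraMap c => simp
  | add f g _ _ hf hg => simpa using add_mem hf hg
  | mul f g _ _ hf hg => simpa using mul_mem hf hg

lemma leftDeriv_mem_adjoin {S : Set J} (x : J) {f : SuperPoly 𝕜 p}
    (hf : f ∈ Algebra.adjoin 𝕜 (gen 𝕜 p '' S)) :
    leftDeriv 𝕜 p x f ∈ Algebra.adjoin 𝕜 (gen 𝕜 p '' S) := by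
  induction hf using Algebra.adjoin_induction with
  | mem f h =>
    obtain ⟨y, hy, rfl⟩ := h
    rw [leftDeriv_gen]
    split_ifs
    · exact one_mem _
    · exact zero_mem _
  | algebraMap c => simp
  | add f g _ _ hf hg => simpa using add_mem hf hg
  | mul f g hf' hg' hf hg =>
    rw [leftDeriv_mul]
    exact add_mem (mul_mem hf hg') (mul_mem (twist_mem_adjoin _ hf') hg)

end SuperPoly

/-! ### Total derivatives and functional derivatives of jet polynomials -/

section Jets

variable {ι G : Type*} {𝕜 : Type*} [Field 𝕜] {d : ℕ} {ε : ι → ZMod 2} {η : G → ZMod 2}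

lemma jetTotalDerivHom_eq (μ : Fin d) (f : JetPoly 𝕜 d ε η) :
    jetTotalDerivHom 𝕜 d ε η μ f = !![f, jetTotalDeriv 𝕜 d ε η μ f; 0, f] := by
  have h : jetTotalDerivHom 𝕜 d ε η μ f 0 0 = f ∧ jetTotalDerivHom 𝕜 d ε η μ f 1 0 = 0 ∧
      jetTotalDerivHom 𝕜 d ε η μ f 1 1 = f := by
    induction f using SuperPoly.induction with
    | h0 c => simp [Matrix.algebraMap_matrix_apply]
    | h1 y => simp [jetTotalDerivHom]
    | hadd f g hf hg => simp [hf, hg]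
    | hmul f g hf hg => simp [hf, hg, Matrix.mul_apply]
  ext i j
  fin_cases i <;> fin_cases j
  · exact h.1
  · rfl
  · exact h.2.1
  · exact h.2.2

lemma jetTotalDeriv_mul (μ : Fin d) (f g : JetPoly 𝕜 d ε η) : jetTotalDeriv 𝕜 d ε η μ (f * g) =
    jetTotalDeriv 𝕜 d ε η μ f * g + f * jetTotalDeriv 𝕜 d ε η μ g := by
  have h : jetTotalDeriv 𝕜 d ε η μ (f * g) = jetTotalDerivHom 𝕜 d ε η μ (f * g) 0 1 := rfl
  rw [h, map_mul, jetTotalDerivHom_eq, jetTotalDerivHom_eq]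
  simp [Matrix.mul_apply, add_comm]

@[simp] lemma jetTotalDeriv_algebraMap (μ : Fin d) (c : 𝕜) :
    jetTotalDeriv 𝕜 d ε η μ (algebraMap 𝕜 _ c) = 0 := by
  simp [jetTotalDeriv, Matrix.algebraMap_matrix_apply]

@[simp] lemma jetTotalDeriv_gen (μ : Fin d) (j : Var ι G × (Fin d → ℕ)) :
    jetTotalDeriv 𝕜 d ε η μ (gen 𝕜 _ j) = gen 𝕜 _ (j.1, j.2 + Pi.single μ 1) := by
  simp [jetTotalDeriv, jetTotalDerivHom]

lemma jetTotalDeriv_twist (μ : Fin d) (s : ZMod 2) (f : JetPoly 𝕜 d ε η) :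
    jetTotalDeriv 𝕜 d ε η μ (twist s f) = twist s (jetTotalDeriv 𝕜 d ε η μ f) := by
  induction f using SuperPoly.induction with
  | h0 c => simp
  | h1 y => simp
  | hadd f g hf hg => simp [hf, hg]
  | hmul f g hf hg => simp [hf, hg, jetTotalDeriv_mul]

lemma jetTotalDeriv_comm (μ ν : Fin d) (f : JetPoly 𝕜 d ε η) :
    jetTotalDeriv 𝕜 d ε η μ (jetTotalDeriv 𝕜 d ε η ν f) =
      jetTotalDeriv 𝕜 d ε η ν (jetTotalDeriv 𝕜 d ε η μ f) := by
  induction f using SuperPoly.induction with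
  | h0 c => simp
  | h1 y => simp [add_right_comm]
  | hadd f g hf hg => simp [hf, hg]
  | hmul f g hf hg =>
    simp only [hf, hg, jetTotalDeriv_mul, map_add]
    abel

lemma prod_pow_add_single {ι' M : Type*} [DecidableEq ι'] [Monoid M] (a : ι' → M)
    (ha : ∀ i j, Commute (a i) (a j)) (l : List ι') (hl : l.Nodup) (m : ι' → ℕ) (i : ι')
    (hi : i ∈ l) : (l.map fun j => a j ^ (m + Pi.single i 1 : ι' → ℕ) j).prod =
      a i * (l.map fun j => a j ^ m j).prod := by
  induction l with
  | nil => simp at hi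
  | cons k l ih =>
    simp only [List.map_cons, List.prod_cons]
    rw [List.nodup_cons] at hl
    by_cases hk : i = k
    · subst hk
      have : (l.map fun j => a j ^ (m + Pi.single i 1 : ι' → ℕ) j) = l.map fun j => a j ^ m j := by
        refine List.map_congr_left fun j hj => ?_
        rw [Pi.add_apply, Pi.single_eq_of_ne, add_zero]
        rintro rfl
        exact hl.1 hj
      rw [this, Pi.add_apply, Pi.single_eq_same, pow_succ', mul_assoc]
    · rw [ih hl.2 (by simpa [hk] using hi), Pi.add_apply, Pi.single_eq_of_ne (Ne.symm hk),
        add_zero, ← mul_assoc, ← mul_assoc, ((ha k i).pow_left _).eq]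

lemma jetTotalDerivs_zero : jetTotalDerivs 𝕜 d ε η 0 = 1 := by
  simp [jetTotalDerivs]

lemma jetTotalDerivs_add_single (m : Fin d → ℕ) (μ : Fin d) (f : JetPoly 𝕜 d ε η) :
    jetTotalDerivs 𝕜 d ε η (m + Pi.single μ 1) f =
      jetTotalDeriv 𝕜 d ε η μ (jetTotalDerivs 𝕜 d ε η m f) := by
  have h := prod_pow_add_single (fun μ => (jetTotalDeriv 𝕜 d ε η μ : Module.End 𝕜 _))
    (fun μ ν => LinearMap.ext (jetTotalDeriv_comm μ ν)) _ (List.nodup_finRange d) m μ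
    (List.mem_finRange μ)
  exact DFunLike.congr_fun h f

/-- Induction on the order |m|: a nonzero multi-index has a positive entry, which can be lowered by
one. -/
theorem multiIndex_induction {P : (Fin d → ℕ) → Prop} (h0 : P 0)
    (h1 : ∀ m μ, P m → P (m + Pi.single μ 1)) (m : Fin d → ℕ) : P m := by
  induction h : ∑ μ, m μ generalizing m with
  | zero =>
    have : m = 0 := by
      ext μ
      simpa using (Finset.sum_eq_zero_iff.1 h) μ (Finset.mem_univ _)
    exact this ▸ h0
  | succ n ih =>
    obtain ⟨μ, -, hμ⟩ : ∃ μ ∈ Finset.univ, m μ ≠ 0 := by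
      by_contra! hm
      rw [Finset.sum_eq_zero hm] at h
      omega
    have hm : m - Pi.single μ 1 + Pi.single μ 1 = m := by
      ext ν
      by_cases hν : ν = μ
      · subst hν
        simp only [Pi.add_apply, Pi.sub_apply, Pi.single_eq_same]
        omega
      · simp [hν]
    rw [← hm]
    refine h1 _ _ (ih _ ?_)
    have h2 : ∑ ν, m ν = ∑ ν, (m - Pi.single μ 1 : Fin d → ℕ) ν + 1 := by
      conv_lhs => rw [← hm]
      simp [Finset.sum_add_distrib]
    omega

lemma jetTotalDerivs_gen (m : Fin d → ℕ) (j : Var ι G × (Fin d → ℕ)) :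
    jetTotalDerivs 𝕜 d ε η m (gen 𝕜 _ j) = gen 𝕜 _ (j.1, j.2 + m) := by
  induction m using multiIndex_induction with
  | h0 => simp [jetTotalDerivs_zero]
  | h1 m μ ih => rw [jetTotalDerivs_add_single, ih, jetTotalDeriv_gen, add_assoc]

lemma jetTotalDerivs_comm (m : Fin d → ℕ) (μ : Fin d) (f : JetPoly 𝕜 d ε η) :
    jetTotalDerivs 𝕜 d ε η m (jetTotalDeriv 𝕜 d ε η μ f) =
      jetTotalDeriv 𝕜 d ε η μ (jetTotalDerivs 𝕜 d ε η m f) := by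
  induction m using multiIndex_induction with
  | h0 => simp [jetTotalDerivs_zero]
  | h1 m ν ih => rw [jetTotalDerivs_add_single, ih, jetTotalDerivs_add_single, jetTotalDeriv_comm]

lemma jetTotalDerivs_twist (m : Fin d → ℕ) (s : ZMod 2) (f : JetPoly 𝕜 d ε η) :
    jetTotalDerivs 𝕜 d ε η m (twist s f) = twist s (jetTotalDerivs 𝕜 d ε η m f) := by
  induction m using multiIndex_induction with
  | h0 => simp [jetTotalDerivs_zero]
  | h1 m ν ih => rw [jetTotalDerivs_add_single, ih, jetTotalDerivs_add_single, jetTotalDeriv_twist]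

lemma leftDeriv_jetTotalDeriv_of_eq_zero (v : Var ι G) (m : Fin d → ℕ) (μ : Fin d) (hm : m μ = 0)
    (f : JetPoly 𝕜 d ε η) : leftDeriv 𝕜 _ (v, m) (jetTotalDeriv 𝕜 d ε η μ f) =
      jetTotalDeriv 𝕜 d ε η μ (leftDeriv 𝕜 _ (v, m) f) := by
  have h1 : ∀ c : Prop, [Decidable c] →
      jetTotalDeriv 𝕜 d ε η μ (if c then 1 else 0) = 0 := by
    intro c _
    split_ifs
    · simpa using jetTotalDeriv_algebraMap (ε := ε) (η := η) μ (1 : 𝕜)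
    · simp
  induction f using SuperPoly.induction with
  | h0 c => simp
  | h1 y =>
    rw [jetTotalDeriv_gen, leftDeriv_gen, leftDeriv_gen, h1, if_neg]
    rintro h
    have := congrFun (congrArg Prod.snd h) μ
    simp [hm] at this
  | hadd f g hf hg => simp [hf, hg]
  | hmul f g hf hg =>
    simp only [leftDeriv_mul, jetTotalDeriv_mul, map_add, hf, hg, jetTotalDeriv_twist]
    abel

/-- With the preceding case of a vanishing μ-entry, this is the commutator [∂/∂(∂^k v), ∂_μ] =
∂/∂(∂^(k-μ) v), split in two so that no multi-index is subtracted. -/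
lemma leftDeriv_jetTotalDeriv_add_single (v : Var ι G) (m : Fin d → ℕ) (μ : Fin d)
    (f : JetPoly 𝕜 d ε η) :
    leftDeriv 𝕜 _ (v, m + Pi.single μ 1) (jetTotalDeriv 𝕜 d ε η μ f) =
      jetTotalDeriv 𝕜 d ε η μ (leftDeriv 𝕜 _ (v, m + Pi.single μ 1) f) +
        leftDeriv 𝕜 _ (v, m) f := by
  have h1 : ∀ c : Prop, [Decidable c] →
      jetTotalDeriv 𝕜 d ε η μ (if c then 1 else 0) = 0 := by
    intro c _
    split_ifs
    · simpa using jetTotalDeriv_algebraMap (ε := ε) (η := η) μ (1 : 𝕜)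
    · simp
  induction f using SuperPoly.induction with
  | h0 c => simp
  | h1 y =>
    rw [jetTotalDeriv_gen, leftDeriv_gen, leftDeriv_gen, leftDeriv_gen, h1, zero_add]
    congr 1
    simp [Prod.ext_iff]
  | hadd f g hf hg =>
    simp only [map_add, hf, hg]
    abel
  | hmul f g hf hg =>
    simp only [leftDeriv_mul, jetTotalDeriv_mul, map_add, hf, hg, jetTotalDeriv_twist, add_mul,
      mul_add]
    abel

/-! ### Functional derivatives of polynomials -/

lemma finite_leftDeriv_jet (v : Var ι G) (f : JetPoly 𝕜 d ε η) :
    {m : Fin d → ℕ | leftDeriv 𝕜 _ (v, m) f ≠ 0}.Finite :=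
  Set.Finite.preimage (fun _ _ _ _ h => (Prod.ext_iff.1 h).2) (finite_leftDeriv f)

/-- The `m`-th term of the functional derivative `jetLeftFun`. -/
def jetLeftFunTerm (v : Var ι G) (m : Fin d → ℕ) : JetPoly 𝕜 d ε η →ₗ[𝕜] JetPoly 𝕜 d ε η :=
  (-1 : 𝕜) ^ (∑ μ, m μ) • jetTotalDerivs 𝕜 d ε η m ∘ₗ leftDeriv 𝕜 _ (v, m)

lemma finite_jetLeftFunTerm (v : Var ι G) (f : JetPoly 𝕜 d ε η) :
    (Function.support fun m => jetLeftFunTerm (𝕜 := 𝕜) (ε := ε) (η := η) v m f).Finite :=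
  (finite_leftDeriv_jet v f).subset fun m hm h => hm (by simp [jetLeftFunTerm, h])

/-- The left functional derivative of polynomials. -/
def jetLeftFun (v : Var ι G) : JetPoly 𝕜 d ε η →ₗ[𝕜] JetPoly 𝕜 d ε η where
  toFun f := ∑ᶠ m, jetLeftFunTerm v m f
  map_add' f g := by
    simp only [map_add]
    exact finsum_add_distrib (finite_jetLeftFunTerm v f) (finite_jetLeftFunTerm v g)
  map_smul' c f := by
    simp only [map_smul, RingHom.id_apply]
    exact (smul_finsum' c (finite_jetLeftFunTerm v f)).symm

lemma jetLeftFun_apply (v : Var ι G) (f : JetPoly 𝕜 d ε η) :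
    jetLeftFun v f = ∑ᶠ m, jetLeftFunTerm v m f := rfl

lemma map_jetLeftFun {R : Type*} [AddCommMonoid R] [Module 𝕜 R] (L : JetPoly 𝕜 d ε η →ₗ[𝕜] R)
    (v : Var ι G) (f : JetPoly 𝕜 d ε η) :
    L (jetLeftFun v f) = ∑ᶠ m, L (jetLeftFunTerm v m f) :=
  L.toAddMonoidHom.map_finsum (finite_jetLeftFunTerm v f)

lemma jetLeftFun_twist (v : Var ι G) (s : ZMod 2) (f : JetPoly 𝕜 d ε η) :
    jetLeftFun v (twist s f) = sgn 𝕜 (s * v.parity ε η) • twist s (jetLeftFun v f) := by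
  have h := map_jetLeftFun (sgn 𝕜 (s * v.parity ε η) •
    (twist s : JetPoly 𝕜 d ε η →ₐ[𝕜] _).toLinearMap) v f
  rw [LinearMap.smul_apply, AlgHom.toLinearMap_apply] at h
  rw [h, jetLeftFun_apply]
  refine finsum_congr fun m => ?_
  simp [jetLeftFunTerm, leftDeriv_twist, jetTotalDerivs_twist]

/-- The commutator of ∂/∂(∂^m v) with ∂_μ makes the sum telescope: each term is a difference between
a family `t` and its shift `t'` by one unit in direction μ, and both families have the same finite
sum. -/
lemma jetLeftFun_jetTotalDeriv (v : Var ι G) (μ : Fin d) (f : JetPoly 𝕜 d ε η) :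
    jetLeftFun v (jetTotalDeriv 𝕜 d ε η μ f) = 0 := by
  classical
  let t : (Fin d → ℕ) → JetPoly 𝕜 d ε η := fun m => jetTotalDeriv 𝕜 d ε η μ (jetLeftFunTerm v m f)
  have ht : (Function.support t).Finite :=
    (finite_jetLeftFunTerm v f).subset fun m hm h => hm (by simp [t, h])
  -- Subtraction of naturals is truncated, so the case `m μ = 0`, where the commutator contributes
  -- nothing, is set to 0 by hand.
  let t' : (Fin d → ℕ) → JetPoly 𝕜 d ε η := fun m => if m μ = 0 then 0 else t (m - Pi.single μ 1)
  have hinj : Function.Injective fun m : Fin d → ℕ => m + Pi.single μ 1 := add_left_injective _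
  have hsub : Function.support t' ⊆ Set.range fun m : Fin d → ℕ => m + Pi.single μ 1 := by
    intro m hm
    refine ⟨m - Pi.single μ 1, ?_⟩
    have hm0 : m μ ≠ 0 := fun h => hm (by simp [t', h])
    ext ν
    by_cases hν : ν = μ
    · subst hν
      simp only [Pi.add_apply, Pi.sub_apply, Pi.single_eq_same]
      omega
    · simp [hν]
  have htt' : ∀ m, t' (m + Pi.single μ 1) = t m := by
    intro m
    have : m + Pi.single μ 1 - Pi.single μ 1 = m := by ext; simp
    simp [t', this]
  have ht' : (Function.support t').Finite := by
    refine (ht.image fun m => m + Pi.single μ 1).subset fun m hm => ?_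
    obtain ⟨k, rfl⟩ := hsub hm
    exact ⟨k, by simpa [htt'] using hm, rfl⟩
  have hsum : ∑ᶠ m, t' m = ∑ᶠ m, t m := by
    rw [← finsum_mem_univ, ← finsum_mem_inter_support, Set.univ_inter,
      ← Set.inter_eq_self_of_subset_right hsub, finsum_mem_inter_support, finsum_mem_range hinj]
    exact finsum_congr htt'
  have hterm : ∀ m, jetLeftFunTerm v m (jetTotalDeriv 𝕜 d ε η μ f) = t m - t' m := by
    intro m
    by_cases hm : m μ = 0
    · simp [t, t', jetLeftFunTerm, hm, leftDeriv_jetTotalDeriv_of_eq_zero, jetTotalDerivs_comm]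
    · obtain ⟨k, rfl⟩ : ∃ k : Fin d → ℕ, k + Pi.single μ 1 = m := by
        refine ⟨m - Pi.single μ 1, ?_⟩
        ext ν
        by_cases hν : ν = μ
        · subst hν
          simp only [Pi.add_apply, Pi.sub_apply, Pi.single_eq_same]
          omega
        · simp [hν]
      rw [htt']
      simp [t, jetLeftFunTerm, leftDeriv_jetTotalDeriv_add_single, jetTotalDerivs_comm,
        jetTotalDerivs_add_single, Finset.sum_add_distrib, pow_succ, sub_eq_add_neg]
      exact (neg_smul _ _).symm
  rw [jetLeftFun_apply, finsum_congr hterm, finsum_sub_distrib ht ht', hsum, sub_self]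

lemma rightFun_term_eq (v : Var ι G) (m : Fin d → ℕ) (f : JetPoly 𝕜 d ε η) :
    (-1 : 𝕜) ^ (∑ μ, m μ) • jetTotalDerivs 𝕜 d ε η m (rightDeriv 𝕜 _ (v, m) f) =
      sgn 𝕜 (v.parity ε η) • jetLeftFunTerm v m (twist (v.parity ε η) f) := by
  simp [rightDeriv_eq, jetLeftFunTerm, smul_comm (sgn 𝕜 _)]

lemma jetTotalDerivs_mem_adjoin {S : Set (Var ι G)} (m : Fin d → ℕ) {f : JetPoly 𝕜 d ε η}
    (hf : f ∈ Algebra.adjoin 𝕜 (gen 𝕜 _ '' {j | j.1 ∈ S})) :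
    jetTotalDerivs 𝕜 d ε η m f ∈ Algebra.adjoin 𝕜 (gen 𝕜 _ '' {j | j.1 ∈ S}) := by
  have h : ∀ (μ : Fin d) (f : JetPoly 𝕜 d ε η),
      f ∈ Algebra.adjoin 𝕜 (gen 𝕜 _ '' {j : Var ι G × (Fin d → ℕ) | j.1 ∈ S}) →
      jetTotalDeriv 𝕜 d ε η μ f ∈ Algebra.adjoin 𝕜 (gen 𝕜 _ '' {j | j.1 ∈ S}) := by
    intro μ f hf
    induction hf using Algebra.adjoin_induction with
    | mem f h =>
      obtain ⟨y, hy, rfl⟩ := h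
      rw [jetTotalDeriv_gen]
      exact Algebra.subset_adjoin (Set.mem_image_of_mem _ hy)
    | algebraMap c => simp
    | add f g _ _ hf hg => simpa using add_mem hf hg
    | mul f g hf' hg' hf hg =>
      rw [jetTotalDeriv_mul]
      exact add_mem (mul_mem hf hg') (mul_mem hf' hg)
  induction m using multiIndex_induction with
  | h0 => simpa [jetTotalDerivs_zero] using hf
  | h1 m μ ih => rw [jetTotalDerivs_add_single]; exact h _ _ ih

lemma jetLeftFun_mem_adjoin {S : Set (Var ι G)} (v : Var ι G) {f : JetPoly 𝕜 d ε η}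
    (hf : f ∈ Algebra.adjoin 𝕜 (gen 𝕜 _ '' {j | j.1 ∈ S})) :
    jetLeftFun v f ∈ Algebra.adjoin 𝕜 (gen 𝕜 _ '' {j | j.1 ∈ S}) := by
  rw [jetLeftFun_apply]
  refine finsum_induction _ (zero_mem _) (fun _ _ => add_mem) fun m => ?_
  exact Subalgebra.smul_mem _ (jetTotalDerivs_mem_adjoin m (leftDeriv_mem_adjoin _ hf)) _

lemma jetLeftFun_eq_zero_of_mem_adjoin {S : Set (Var ι G)} {v : Var ι G} (hv : v ∉ S)
    {f : JetPoly 𝕜 d ε η} (hf : f ∈ Algebra.adjoin 𝕜 (gen 𝕜 _ '' {j | j.1 ∈ S})) :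
    jetLeftFun v f = 0 := by
  rw [jetLeftFun_apply]
  refine finsum_eq_zero_of_forall_eq_zero fun m => ?_
  have h : (v, m) ∉ {j : Var ι G × (Fin d → ℕ) | j.1 ∈ S} := hv
  rw [jetLeftFunTerm, LinearMap.smul_apply, LinearMap.comp_apply,
    leftDeriv_eq_zero_of_mem_adjoin h hf, map_zero, smul_zero]

end Jets

/-! ### Maps linear over the expansion parameter -/

section Assemble

variable {ι G : Type*} {𝕜 : Type*} [Field 𝕜] {d : ℕ} {ε : ι → ZMod 2} {η : G → ZMod 2}

/-- The density `∑ n, X ^ n * h n`. -/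
def assemble (h : ℕ → Density 𝕜 d ε η) : Density 𝕜 d ε η :=
  PowerSeries.mk fun k => ∑ p ∈ Finset.HasAntidiagonal.antidiagonal k, PowerSeries.coeff p.2 (h p.1)

/-- The recursion determines the coefficient of order k+1 from coefficients of order k of the
shifted sequence, so induction on k, over all sequences at once, replaces a convergence argument. -/
lemma eq_of_shift {α : Type*} {F F' : (ℕ → α) → Density 𝕜 d ε η} {g : α → Density 𝕜 d ε η}
    (hF : ∀ h, F h = g (h 0) + PowerSeries.X * F fun n => h (n + 1))
    (hF' : ∀ h, F' h = g (h 0) + PowerSeries.X * F' fun n => h (n + 1)) (h : ℕ → α) :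
    F h = F' h := by
  ext k
  induction k generalizing h with
  | zero => rw [hF, hF']; simp
  | succ k ih =>
    rw [hF, hF', map_add, map_add, PowerSeries.coeff_succ_X_mul, PowerSeries.coeff_succ_X_mul, ih]

lemma assemble_shift (h : ℕ → Density 𝕜 d ε η) :
    assemble h = h 0 + PowerSeries.X * assemble fun n => h (n + 1) := by
  ext k
  cases k with
  | zero => simp [assemble]
  | succ k =>
    rw [map_add, PowerSeries.coeff_succ_X_mul]
    simp [assemble, Finset.Nat.sum_antidiagonal_succ]

@[simp] lemma assemble_zero : assemble (fun _ => (0 : Density 𝕜 d ε η)) = 0 := by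
  ext; simp [assemble]

lemma assemble_C (h : ℕ → JetPoly 𝕜 d ε η) :
    assemble (fun n => PowerSeries.C (h n)) = PowerSeries.mk h := by
  refine eq_of_shift (F := fun h : ℕ → JetPoly 𝕜 d ε η => assemble fun n => PowerSeries.C (h n))
    (F' := PowerSeries.mk) (g := PowerSeries.C) (fun h => assemble_shift _) (fun h => ?_) h
  ext k
  cases k with
  | zero => simp
  | succ k => rw [map_add, PowerSeries.coeff_succ_X_mul]; simp

lemma assemble_coeff (f : Density 𝕜 d ε η) :
    assemble (fun n => PowerSeries.C (PowerSeries.coeff n f)) = f := by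
  rw [assemble_C]; ext; simp

/-- Linearity over series in the expansion parameter. -/
def XLinear (L : Density 𝕜 d ε η →ₗ[𝕜] Density 𝕜 d ε η) : Prop :=
  ∀ f, L (PowerSeries.X * f) = PowerSeries.X * L f

lemma XLinear.map_assemble {L : Density 𝕜 d ε η →ₗ[𝕜] Density 𝕜 d ε η} (hL : XLinear L)
    (h : ℕ → Density 𝕜 d ε η) : L (assemble h) = assemble fun n => L (h n) := by
  refine eq_of_shift (F := fun h => L (assemble h)) (F' := fun h => assemble fun n => L (h n))
    (g := L) (fun h => ?_) (fun h => assemble_shift _) h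
  rw [assemble_shift, map_add, hL]

lemma XLinear.eq_assemble {L : Density 𝕜 d ε η →ₗ[𝕜] Density 𝕜 d ε η} (hL : XLinear L)
    (f : Density 𝕜 d ε η) :
    L f = assemble fun n => L (PowerSeries.C (PowerSeries.coeff n f)) := by
  conv_lhs => rw [← assemble_coeff f, hL.map_assemble]

/-- Linearity over X already forces compatibility with infinite sums ∑ Xⁿ hₙ, so constant series,
that is, polynomials, determine the map. -/
theorem XLinear.ext {L L' : Density 𝕜 d ε η →ₗ[𝕜] Density 𝕜 d ε η} (hL : XLinear L)
    (hL' : XLinear L') (h : ∀ a, L (PowerSeries.C a) = L' (PowerSeries.C a)) : L = L' := by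
  ext1 f
  rw [hL.eq_assemble, hL'.eq_assemble]
  simp only [h]

lemma XLinear.comp {L L' : Density 𝕜 d ε η →ₗ[𝕜] Density 𝕜 d ε η} (hL : XLinear L)
    (hL' : XLinear L') : XLinear (L ∘ₗ L') := fun f => by
  simp [hL' f, hL (L' f)]

lemma XLinear.add {L L' : Density 𝕜 d ε η →ₗ[𝕜] Density 𝕜 d ε η} (hL : XLinear L)
    (hL' : XLinear L') : XLinear (L + L') := fun f => by
  simp [hL' f, hL f, mul_add]

lemma XLinear.smul {L : Density 𝕜 d ε η →ₗ[𝕜] Density 𝕜 d ε η} (c : 𝕜) (hL : XLinear L) :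
    XLinear (c • L) := fun f => by
  simp [hL f]

lemma xLinear_mulLeft (w : Density 𝕜 d ε η) : XLinear (LinearMap.mulLeft 𝕜 w) := fun f => by
  simp only [LinearMap.mulLeft_apply]
  rw [← mul_assoc, (PowerSeries.commute_X w).eq, mul_assoc]

lemma xLinear_mulRight (w : Density 𝕜 d ε η) : XLinear (LinearMap.mulRight 𝕜 w) := fun f => by
  simp only [LinearMap.mulRight_apply, mul_assoc]

lemma xLinear_mapCoeff (L : JetPoly 𝕜 d ε η →ₗ[𝕜] JetPoly 𝕜 d ε η) : XLinear (mapCoeff L) := by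
  intro f
  ext k
  cases k with
  | zero => simp [mapCoeff]
  | succ k => rw [PowerSeries.coeff_succ_X_mul]; simp [mapCoeff, PowerSeries.coeff_succ_X_mul]

@[simp] lemma mapCoeff_C (L : JetPoly 𝕜 d ε η →ₗ[𝕜] JetPoly 𝕜 d ε η) (a : JetPoly 𝕜 d ε η) :
    mapCoeff L (PowerSeries.C a) = PowerSeries.C (L a) := by
  ext k
  simp only [mapCoeff, LinearMap.coe_mk, AddHom.coe_mk, PowerSeries.coeff_mk, PowerSeries.coeff_C]
  split_ifs <;> simp

@[simp] lemma coeff_mapCoeff (L : JetPoly 𝕜 d ε η →ₗ[𝕜] JetPoly 𝕜 d ε η) (n : ℕ)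
    (f : Density 𝕜 d ε η) :
    PowerSeries.coeff n (mapCoeff L f) = L (PowerSeries.coeff n f) := by
  simp [mapCoeff]

/-- The extension of a linear map on polynomials to densities. -/
def extend (L : JetPoly 𝕜 d ε η →ₗ[𝕜] Density 𝕜 d ε η) :
    Density 𝕜 d ε η →ₗ[𝕜] Density 𝕜 d ε η where
  toFun f := assemble fun n => L (PowerSeries.coeff n f)
  map_add' f g := by
    ext k
    simp [assemble, Finset.sum_add_distrib]
  map_smul' c f := by
    ext k
    simp [assemble, Finset.smul_sum]

lemma extend_apply (L : JetPoly 𝕜 d ε η →ₗ[𝕜] Density 𝕜 d ε η) (f : Density 𝕜 d ε η) :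
    extend L f = assemble fun n => L (PowerSeries.coeff n f) := rfl

lemma xLinear_extend (L : JetPoly 𝕜 d ε η →ₗ[𝕜] Density 𝕜 d ε η) : XLinear (extend L) := by
  intro f
  rw [extend_apply, assemble_shift]
  simp [PowerSeries.coeff_succ_X_mul, extend_apply]

@[simp] lemma extend_C (L : JetPoly 𝕜 d ε η →ₗ[𝕜] Density 𝕜 d ε η) (a : JetPoly 𝕜 d ε η) :
    extend L (PowerSeries.C a) = L a := by
  rw [extend_apply, assemble_shift]
  simp [PowerSeries.coeff_C]

lemma C_smul (c : 𝕜) (a : JetPoly 𝕜 d ε η) :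
    (PowerSeries.C (c • a) : Density 𝕜 d ε η) = c • PowerSeries.C a := by
  ext k
  simp only [PowerSeries.coeff_smul, PowerSeries.coeff_C]
  split_ifs <;> simp

lemma C_algebraMap (c : 𝕜) :
    (PowerSeries.C (algebraMap 𝕜 (JetPoly 𝕜 d ε η) c) : Density 𝕜 d ε η) = c • 1 := by
  rw [Algebra.algebraMap_eq_smul_one, C_smul, map_one]

end Assemble

/-! ### Parity, functional derivatives and integration by parts for densities -/

section DensityOps

variable {ι G : Type*} {𝕜 : Type*} [Field 𝕜] {d : ℕ} {ε : ι → ZMod 2} {η : G → ZMod 2}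

lemma density_mul_neg (f g : Density 𝕜 d ε η) : f * -g = -(f * g) := mul_neg f g

lemma density_neg_mul (f g : Density 𝕜 d ε η) : -f * g = -(f * g) := neg_mul f g

/-- The map `f ↦ (-1)^(s|f|) f` on densities. -/
def tw (s : ZMod 2) : Density 𝕜 d ε η →ₗ[𝕜] Density 𝕜 d ε η := mapCoeff (twist s).toLinearMap

lemma parityMap_eq_tw (f : Density 𝕜 d ε η) : parityMap f = tw 1 f := by
  ext; simp [parityMap, tw, parityHom_eq_twist]

lemma mapCoeff_mul_of_algHom (L : JetPoly 𝕜 d ε η →ₐ[𝕜] JetPoly 𝕜 d ε η) (f g : Density 𝕜 d ε η) :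
    mapCoeff L.toLinearMap (f * g) = mapCoeff L.toLinearMap f * mapCoeff L.toLinearMap g := by
  ext k
  simp [PowerSeries.coeff_mul]

lemma tw_mul (s : ZMod 2) (f g : Density 𝕜 d ε η) : tw s (f * g) = tw s f * tw s g :=
  mapCoeff_mul_of_algHom _ _ _

lemma tw_tw (s t : ZMod 2) (f : Density 𝕜 d ε η) : tw s (tw t f) = tw (s + t) f := by
  ext; simp [tw, twist_twist]

@[simp] lemma tw_zero (f : Density 𝕜 d ε η) : tw 0 f = f := by
  ext; simp [tw, twist_zero]

@[simp] lemma tw_C (s : ZMod 2) (a : JetPoly 𝕜 d ε η) :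
    tw s (PowerSeries.C a) = PowerSeries.C (twist s a) := mapCoeff_C _ _

@[simp] lemma tw_var (s : ZMod 2) (v : Var ι G) :
    tw s (var v : Density 𝕜 d ε η) = sgn 𝕜 (s * v.parity ε η) • var v := by
  simp [var, C_smul]

lemma hasParity_iff {q : ZMod 2} {f : Density 𝕜 d ε η} : HasParity q f ↔ tw 1 f = sgn 𝕜 q • f := by
  rw [HasParity, parityMap_eq_tw]

lemma HasParity.tw_eq {q : ZMod 2} {f : Density 𝕜 d ε η} (hf : HasParity q f) (s : ZMod 2) :
    tw s f = sgn 𝕜 (s * q) • f := by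
  rcases zmod2_cases s with rfl | rfl
  · simp
  · simpa using hasParity_iff.1 hf

lemma hasParity_var (v : Var ι G) : HasParity (v.parity ε η) (var v : Density 𝕜 d ε η) := by
  rw [hasParity_iff]; simp

lemma HasParity.mul {q r : ZMod 2} {f g : Density 𝕜 d ε η} (hf : HasParity q f)
    (hg : HasParity r g) : HasParity (q + r) (f * g) := by
  rw [hasParity_iff, tw_mul, hasParity_iff.1 hf, hasParity_iff.1 hg, smul_mul_smul_comm, sgn_add]

lemma HasParity.add {q : ZMod 2} {f g : Density 𝕜 d ε η} (hf : HasParity q f)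
    (hg : HasParity q g) : HasParity q (f + g) := by
  rw [hasParity_iff, map_add, hasParity_iff.1 hf, hasParity_iff.1 hg, smul_add]

lemma HasParity.smul {q : ZMod 2} {f : Density 𝕜 d ε η} (c : 𝕜) (hf : HasParity q f) :
    HasParity q (c • f) := by
  rw [hasParity_iff, map_smul, hasParity_iff.1 hf, smul_comm]

lemma HasParity.neg {q : ZMod 2} {f : Density 𝕜 d ε η} (hf : HasParity q f) :
    HasParity q (-f) := by
  rw [hasParity_iff, map_neg, hasParity_iff.1 hf, smul_neg]

lemma hasParity_zero (q : ZMod 2) : HasParity q (0 : Density 𝕜 d ε η) := by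
  rw [hasParity_iff]; simp

lemma HasParity.mul_eq_tw_mul {q : ZMod 2} {w : Density 𝕜 d ε η} (hw : HasParity q w)
    (f : Density 𝕜 d ε η) : w * f = tw q f * w := by
  have hw' : ∀ n, twist 1 (PowerSeries.coeff n w) = sgn 𝕜 q • PowerSeries.coeff n w := by
    intro n
    have := congrArg (PowerSeries.coeff n) (hasParity_iff.1 hw)
    simpa [tw] using this
  ext k
  rw [PowerSeries.coeff_mul, PowerSeries.coeff_mul, ← Finset.Nat.sum_antidiagonal_swap]
  refine Finset.sum_congr rfl fun p _ => ?_
  simpa [tw] using mul_eq_twist_mul (hw' p.2) _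

lemma HasParity.mul_comm {q r : ZMod 2} {f g : Density 𝕜 d ε η} (hf : HasParity q f)
    (hg : HasParity r g) : f * g = sgn 𝕜 (q * r) • (g * f) := by
  rw [hf.mul_eq_tw_mul, hg.tw_eq, smul_mul_assoc]

lemma totalDeriv_mul (μ : Fin d) (f g : Density 𝕜 d ε η) :
    totalDeriv μ (f * g) = totalDeriv μ f * g + f * totalDeriv μ g := by
  ext k
  simp [totalDeriv, PowerSeries.coeff_mul, jetTotalDeriv_mul, Finset.sum_add_distrib]

lemma totalDeriv_tw (μ : Fin d) (s : ZMod 2) (f : Density 𝕜 d ε η) :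
    totalDeriv μ (tw s f) = tw s (totalDeriv μ f) := by
  ext; simp [totalDeriv, tw, jetTotalDeriv_twist]

/-- The derivative `∂^m` of a density. -/
def totalDerivs (m : Fin d → ℕ) : Density 𝕜 d ε η →ₗ[𝕜] Density 𝕜 d ε η :=
  mapCoeff (jetTotalDerivs 𝕜 d ε η m)

@[simp] lemma totalDerivs_zero (f : Density 𝕜 d ε η) : totalDerivs 0 f = f := by
  ext; simp [totalDerivs, jetTotalDerivs_zero]

lemma totalDerivs_add_single (m : Fin d → ℕ) (μ : Fin d) (f : Density 𝕜 d ε η) :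
    totalDerivs (m + Pi.single μ 1) f = totalDeriv μ (totalDerivs m f) := by
  ext; simp [totalDerivs, totalDeriv, jetTotalDerivs_add_single]

lemma totalDerivs_totalDeriv (m : Fin d → ℕ) (μ : Fin d) (f : Density 𝕜 d ε η) :
    totalDerivs m (totalDeriv μ f) = totalDeriv μ (totalDerivs m f) := by
  ext; simp [totalDerivs, totalDeriv, jetTotalDerivs_comm]

lemma HasParity.totalDerivs {q : ZMod 2} {f : Density 𝕜 d ε η} (hf : HasParity q f)
    (m : Fin d → ℕ) : HasParity q (totalDerivs m f) := by
  have h : tw 1 (BV.totalDerivs m f) = BV.totalDerivs m (tw 1 f) := by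
    ext; simp [tw, BV.totalDerivs, jetTotalDerivs_twist]
  rw [hasParity_iff, h, hasParity_iff.1 hf, map_smul]

lemma totalDerivs_var (m : Fin d → ℕ) (v : Var ι G) :
    totalDerivs m (var v : Density 𝕜 d ε η) = PowerSeries.C (gen 𝕜 _ (v, m)) := by
  simp [totalDerivs, var, jetTotalDerivs_gen]

lemma map_totalDerivs {L : Density 𝕜 d ε η →ₗ[𝕜] Density 𝕜 d ε η}
    (hL : ∀ μ f, L (totalDeriv μ f) = totalDeriv μ (L f)) (m : Fin d → ℕ) (f : Density 𝕜 d ε η) :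
    L (totalDerivs m f) = totalDerivs m (L f) := by
  induction m using multiIndex_induction with
  | h0 => simp
  | h1 m μ ih => rw [totalDerivs_add_single, hL, ih, totalDerivs_add_single]

lemma leftFun_eq_mapCoeff (v : Var ι G) (f : Density 𝕜 d ε η) :
    leftFun v f = mapCoeff (jetLeftFun v) f := by
  ext n
  rw [coeff_mapCoeff, jetLeftFun_apply, leftFun, PowerSeries.coeff_mk]
  rfl

lemma leftFun_add (v : Var ι G) (f g : Density 𝕜 d ε η) :
    leftFun v (f + g) = leftFun v f + leftFun v g := by
  simp only [leftFun_eq_mapCoeff, map_add]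

lemma tw_leftFun (s : ZMod 2) (v : Var ι G) (f : Density 𝕜 d ε η) :
    leftFun v (tw s f) = sgn 𝕜 (s * v.parity ε η) • tw s (leftFun v f) := by
  ext n
  simp [leftFun_eq_mapCoeff, tw, jetLeftFun_twist]

lemma HasParity.leftFun {q : ZMod 2} {f : Density 𝕜 d ε η} (hf : HasParity q f) (v : Var ι G) :
    HasParity (v.parity ε η + q) (leftFun v f) := by
  have h := tw_leftFun 1 v f
  rw [hasParity_iff.1 hf, one_mul] at h
  rw [hasParity_iff, sgn_add, mul_smul]
  simp only [leftFun_eq_mapCoeff, map_smul] at h ⊢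
  rw [h, smul_smul, sgn_mul_self, one_smul]

lemma rightFun_eq (v : Var ι G) (f : Density 𝕜 d ε η) :
    rightFun v f = sgn 𝕜 (v.parity ε η) • leftFun v (tw (v.parity ε η) f) := by
  ext n
  rw [PowerSeries.coeff_smul, leftFun_eq_mapCoeff, coeff_mapCoeff, jetLeftFun_apply, rightFun,
    PowerSeries.coeff_mk, smul_finsum' _ (finite_jetLeftFunTerm v _)]
  refine finsum_congr fun m => ?_
  rw [rightFun_term_eq]
  simp [tw]

lemma HasParity.rightFun_eq {f : Density 𝕜 d ε η} (hf : HasParity 0 f) (v : Var ι G) :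
    rightFun v f = sgn 𝕜 (v.parity ε η) • BV.leftFun v f := by
  rw [BV.rightFun_eq, hf.tw_eq]; simp

lemma totalDeriv_mem (μ : Fin d) (f : Density 𝕜 d ε η) :
    totalDeriv μ f ∈ totalDerivatives 𝕜 d ε η :=
  Submodule.mem_iSup_of_mem μ ⟨f, rfl⟩

/-- One primitive per direction suffices. This uniform shape is what allows infinitely many total
derivatives to be summed. -/
lemma mem_totalDerivatives {f : Density 𝕜 d ε η} : f ∈ totalDerivatives 𝕜 d ε η ↔
    ∃ h : Fin d → Density 𝕜 d ε η, f = ∑ μ, totalDeriv μ (h μ) := by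
  classical
  constructor
  · intro hf
    induction hf using Submodule.iSup_induction' with
    | mem μ x hx =>
      obtain ⟨g, rfl⟩ := hx
      refine ⟨Pi.single μ g, ?_⟩
      rw [Finset.sum_eq_single μ]
      · simp
      · intro ν _ hν
        simp [hν]
      · simp
    | zero => exact ⟨0, by simp⟩
    | add x y _ _ hx hy =>
      obtain ⟨a, rfl⟩ := hx
      obtain ⟨b, rfl⟩ := hy
      exact ⟨a + b, by simp [Finset.sum_add_distrib]⟩
  · rintro ⟨h, rfl⟩
    exact sum_mem fun μ _ => totalDeriv_mem μ _

lemma leftFun_eq_zero_of_mem {f : Density 𝕜 d ε η} (hf : f ∈ totalDerivatives 𝕜 d ε η)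
    (v : Var ι G) : leftFun v f = 0 := by
  obtain ⟨h, rfl⟩ := mem_totalDerivatives.1 hf
  rw [leftFun_eq_mapCoeff, map_sum]
  refine Finset.sum_eq_zero fun μ _ => ?_
  ext n
  simp [totalDeriv, jetLeftFun_jetTotalDeriv]

lemma integral_eq_iff {f g : Density 𝕜 d ε η} :
    integral f = integral g ↔ f - g ∈ totalDerivatives 𝕜 d ε η :=
  Submodule.Quotient.eq _

lemma integral_eq_zero_iff {f : Density 𝕜 d ε η} :
    integral f = 0 ↔ f ∈ totalDerivatives 𝕜 d ε η :=
  Submodule.Quotient.mk_eq_zero _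

lemma leftFun_congr {f g : Density 𝕜 d ε η} (h : integral f = integral g) (v : Var ι G) :
    leftFun v f = leftFun v g := by
  have h1 := leftFun_eq_zero_of_mem (integral_eq_iff.1 h) v
  simpa only [leftFun_eq_mapCoeff, map_sub, sub_eq_zero] using h1

/-- A submodule need not be closed under infinite sums. This one is, because there are only d
directions: primitives are chosen at each order and assembled direction by direction. -/
lemma assemble_mem_totalDerivatives {h : ℕ → Density 𝕜 d ε η}
    (hh : ∀ n, h n ∈ totalDerivatives 𝕜 d ε η) : assemble h ∈ totalDerivatives 𝕜 d ε η := by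
  choose k hk using fun n => mem_totalDerivatives.1 (hh n)
  have h1 : assemble h = ∑ μ, totalDeriv μ (assemble fun n => k n μ) := by
    simp only [totalDeriv, (xLinear_mapCoeff _).map_assemble]
    ext j
    simp only [assemble, PowerSeries.coeff_mk, map_sum]
    rw [Finset.sum_comm]
    refine Finset.sum_congr rfl fun p _ => ?_
    rw [hk, map_sum]
    rfl
  exact mem_totalDerivatives.2 ⟨_, h1⟩

/-- Integration by parts |m| times, one derivative per induction step. -/
lemma totalDerivs_mul_sub_mem (m : Fin d → ℕ) (f g : Density 𝕜 d ε η) :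
    totalDerivs m f * g - f * ((-1 : 𝕜) ^ (∑ μ, m μ) • totalDerivs m g) ∈
      totalDerivatives 𝕜 d ε η := by
  induction m using multiIndex_induction generalizing f g with
  | h0 => simp
  | h1 m μ ih =>
    have h1 := totalDeriv_mem μ (totalDerivs m f * g)
    have h2 := ih f (totalDeriv μ g)
    rw [totalDeriv_mul] at h1
    convert sub_mem h1 h2 using 1
    have h3 : ∑ ν, (m + Pi.single μ 1 : Fin d → ℕ) ν = ∑ ν, m ν + 1 := by
      simp [Finset.sum_add_distrib]
    rw [totalDerivs_add_single, totalDerivs_add_single, totalDerivs_totalDeriv, h3, pow_succ,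
      mul_neg_one, neg_smul, density_mul_neg]
    abel

end DensityOps

/-! ### Sums over all fields -/

section SumLabels

variable {ι G : Type*} [Fintype ι] [Fintype G] {A B : Type*}

lemma sumLabels_add [AddCommMonoid A] (f g : Label ι G → A) :
    sumLabels (fun a => f a + g a) = sumLabels f + sumLabels g := by
  simp only [sumLabels, Finset.sum_add_distrib]
  abel

lemma map_sumLabels [AddCommMonoid A] [AddCommMonoid B] {F : Type*} [FunLike F A B]
    [AddMonoidHomClass F A B] (L : F) (f : Label ι G → A) :
    L (sumLabels f) = sumLabels fun a => L (f a) := by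
  simp only [sumLabels, map_add, map_sum]

lemma sumLabels_sub [AddCommGroup A] (f g : Label ι G → A) :
    sumLabels (fun a => f a - g a) = sumLabels f - sumLabels g := by
  simp only [sumLabels, Finset.sum_add_distrib, Finset.sum_sub_distrib]
  abel

theorem sumLabels_induction [AddCommMonoid A] {P : A → Prop} (h0 : P 0)
    (hadd : ∀ x y, P x → P y → P (x + y)) {f : Label ι G → A} (h : ∀ a, P (f a)) :
    P (sumLabels f) := by
  refine hadd _ _ (Finset.sum_induction _ P hadd h0 fun i _ => ?_)
    (Finset.sum_induction _ P hadd h0 fun I _ => ?_)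
  · exact hadd _ _ (h _) (h _)
  · exact hadd _ _ (hadd _ _ (hadd _ _ (h _) (h _)) (h _)) (h _)

lemma sumLabels_zero [AddCommMonoid A] : sumLabels (fun _ : Label ι G => (0 : A)) = 0 := by
  simp [sumLabels]

open Classical in
lemma sumLabels_ite [AddCommMonoid A] (f : Label ι G → A) (b : Label ι G) :
    sumLabels (fun a => if b = a then f a else 0) = f b := by
  cases b <;> simp [sumLabels]

end SumLabels

/-! ### Evolutionary vector fields and the first variation -/

section Evolutionary

variable {ι G : Type*} {𝕜 : Type*} [Field 𝕜] {d : ℕ} {ε : ι → ZMod 2} {η : G → ZMod 2}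

theorem XLinear.ext_of_mul {L L' : Density 𝕜 d ε η →ₗ[𝕜] Density 𝕜 d ε η} (hL : XLinear L)
    (hL' : XLinear L') (h1 : L 1 = L' 1)
    (hgen : ∀ j, L (PowerSeries.C (gen 𝕜 _ j)) = L' (PowerSeries.C (gen 𝕜 _ j)))
    (hmul : ∀ f g, L f = L' f → L g = L' g → L (f * g) = L' (f * g)) : L = L' := by
  refine hL.ext hL' fun a => ?_
  induction a using SuperPoly.induction with
  | h0 c => rw [C_algebraMap, map_smul, map_smul, h1]
  | h1 j => exact hgen j
  | hadd f g hf hg => rw [map_add, map_add, map_add, hf, hg]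
  | hmul f g hf hg => rw [map_mul]; exact hmul _ _ hf hg

/-- Evolutionary vector fields of parity `s`, as (left) superderivations of the densities. -/
structure IsEvolutionary (s : ZMod 2) (D : Density 𝕜 d ε η →ₗ[𝕜] Density 𝕜 d ε η) : Prop where
  xLinear : XLinear D
  map_mul : ∀ f g, D (f * g) = D f * g + tw s f * D g
  map_totalDeriv : ∀ μ f, D (totalDeriv μ f) = totalDeriv μ (D f)
  map_tw : ∀ f, D (tw 1 f) = sgn 𝕜 s • tw 1 (D f)

namespace IsEvolutionary

variable {s : ZMod 2} {D D' : Density 𝕜 d ε η →ₗ[𝕜] Density 𝕜 d ε η}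

lemma map_one (hD : IsEvolutionary s D) : D 1 = 0 := by
  have h := hD.map_mul 1 1
  have h1 : tw s (1 : Density 𝕜 d ε η) = 1 := by
    rw [← _root_.map_one PowerSeries.C, tw_C, _root_.map_one]
  rw [h1, mul_one, mul_one, one_mul] at h
  simpa using h

/-- Commuting with ∂^m fixes the action on all jets once it is known on undifferentiated variables;
the Leibniz rule and linearity over X do the rest. -/
theorem ext (hD : IsEvolutionary s D) (hD' : IsEvolutionary s D')
    (h : ∀ v, D (var v) = D' (var v)) : D = D' := by
  refine hD.xLinear.ext_of_mul hD'.xLinear (by rw [hD.map_one, hD'.map_one]) (fun j => ?_) ?_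
  · have := totalDerivs_var (𝕜 := 𝕜) (ε := ε) (η := η) j.2 j.1
    rw [← this, map_totalDerivs hD.map_totalDeriv, map_totalDerivs hD'.map_totalDeriv, h]
  · intro f g hf hg
    rw [hD.map_mul, hD'.map_mul, hf, hg]

lemma zero : IsEvolutionary s (0 : Density 𝕜 d ε η →ₗ[𝕜] Density 𝕜 d ε η) where
  xLinear f := by simp
  map_mul f g := by simp
  map_totalDeriv μ f := by simp
  map_tw f := by simp

lemma add (hD : IsEvolutionary s D) (hD' : IsEvolutionary s D') : IsEvolutionary s (D + D') where
  xLinear := hD.xLinear.add hD'.xLinear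
  map_mul f g := by
    simp only [LinearMap.add_apply, hD.map_mul, hD'.map_mul, add_mul, mul_add]
    abel
  map_totalDeriv μ f := by
    simp only [LinearMap.add_apply, hD.map_totalDeriv, hD'.map_totalDeriv, map_add]
  map_tw f := by
    simp only [LinearMap.add_apply, hD.map_tw, hD'.map_tw, map_add, smul_add]

lemma sub (hD : IsEvolutionary s D) (hD' : IsEvolutionary s D') : IsEvolutionary s (D - D') where
  xLinear f := by simp only [LinearMap.sub_apply, hD.xLinear f, hD'.xLinear f, mul_sub]
  map_mul f g := by
    simp only [LinearMap.sub_apply, hD.map_mul, hD'.map_mul, sub_mul, mul_sub]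
    abel
  map_totalDeriv μ f := by
    simp only [LinearMap.sub_apply, hD.map_totalDeriv, hD'.map_totalDeriv, map_sub]
  map_tw f := by
    simp only [LinearMap.sub_apply, hD.map_tw, hD'.map_tw, map_sub, smul_sub]

lemma hasParity (hD : IsEvolutionary s D) {q : ZMod 2} {f : Density 𝕜 d ε η}
    (hf : HasParity q f) : HasParity (q + s) (D f) := by
  have h := hD.map_tw f
  rw [hasParity_iff.1 hf, map_smul] at h
  rw [hasParity_iff, sgn_add, mul_comm, mul_smul, h, smul_smul, sgn_mul_self, one_smul]

/-- The anticommutator of odd vector fields is an even one. -/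
lemma anticomm (hD : IsEvolutionary 1 D) (hD' : IsEvolutionary 1 D') :
    IsEvolutionary 0 (D ∘ₗ D' + D' ∘ₗ D) where
  xLinear := (hD.xLinear.comp hD'.xLinear).add (hD'.xLinear.comp hD.xLinear)
  map_mul f g := by
    simp only [LinearMap.add_apply, LinearMap.comp_apply, hD.map_mul, hD'.map_mul, map_add,
      hD.map_tw, hD'.map_tw, tw_tw, zmod2_add_self, tw_zero, add_mul, mul_add, sgn_one, neg_smul,
      one_smul, density_neg_mul]
    abel
  map_totalDeriv μ f := by
    simp only [LinearMap.add_apply, LinearMap.comp_apply, hD.map_totalDeriv, hD'.map_totalDeriv,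
      map_add]
  map_tw f := by
    simp only [LinearMap.add_apply, LinearMap.comp_apply, hD.map_tw, hD'.map_tw, map_smul,
      smul_smul, sgn_mul_self, map_add, sgn_zero, one_smul]

end IsEvolutionary

/-- `∑ m, ∂^m w * ∂_l a / ∂(∂^m v)` for polynomials `a`. -/
def jetVariation (v : Var ι G) (w : Density 𝕜 d ε η) : JetPoly 𝕜 d ε η →ₗ[𝕜] Density 𝕜 d ε η where
  toFun a := ∑ᶠ m, totalDerivs m w * PowerSeries.C (leftDeriv 𝕜 _ (v, m) a)
  map_add' a b := by
    simp only [map_add, mul_add]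
    refine finsum_add_distrib ((finite_leftDeriv_jet v a).subset fun m hm h => hm ?_)
      ((finite_leftDeriv_jet v b).subset fun m hm h => hm ?_) <;> simp [h]
  map_smul' c a := by
    simp only [map_smul, C_smul, mul_smul_comm, RingHom.id_apply]
    refine (smul_finsum' c ((finite_leftDeriv_jet v a).subset fun m hm h => hm ?_)).symm
    simp [h]

lemma finite_jetVariation (v : Var ι G) (w : Density 𝕜 d ε η) (a : JetPoly 𝕜 d ε η) :
    (Function.support fun m =>
      totalDerivs m w * PowerSeries.C (leftDeriv 𝕜 _ (v, m) a)).Finite :=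
  (finite_leftDeriv_jet v a).subset fun m hm h => hm (by simp [h])

lemma jetVariation_apply (v : Var ι G) (w : Density 𝕜 d ε η) (a : JetPoly 𝕜 d ε η) :
    jetVariation v w a = ∑ᶠ m, totalDerivs m w * PowerSeries.C (leftDeriv 𝕜 _ (v, m) a) := rfl

/-- The evolutionary vector field that sends `v` to `w` and kills the other variables. -/
def variation (v : Var ι G) (w : Density 𝕜 d ε η) : Density 𝕜 d ε η →ₗ[𝕜] Density 𝕜 d ε η :=
  extend (jetVariation v w)

/-- In the second Leibniz term ∂^m w, of parity |v| + s, must cross a factor already twisted by |v|.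
The two |v|-twists cancel and only the twist by s remains. -/
lemma jetVariation_mul {s : ZMod 2} {v : Var ι G} {w : Density 𝕜 d ε η}
    (hw : HasParity (v.parity ε η + s) w) (a b : JetPoly 𝕜 d ε η) :
    jetVariation v w (a * b) = jetVariation v w a * PowerSeries.C b +
      PowerSeries.C (twist s a) * jetVariation v w b := by
  simp only [jetVariation_apply]
  rw [finsum_mul' _ _ (finite_jetVariation v w a), mul_finsum' _ _ (finite_jetVariation v w b),
    ← finsum_add_distrib]
  · refine finsum_congr fun m => ?_
    rw [leftDeriv_mul, map_add, map_mul, map_mul, mul_add, mul_assoc, ← mul_assoc, ← mul_assoc _ _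
      (PowerSeries.C (leftDeriv 𝕜 _ (v, m) b)), show (v, m).1 = v from rfl,
      (hw.totalDerivs m).mul_eq_tw_mul (PowerSeries.C (twist (v.parity ε η) a)), tw_C, twist_twist,
      add_right_comm, zmod2_add_self, zero_add, mul_assoc (PowerSeries.C (twist s a))]
  · refine (finite_jetVariation v w a).subset fun m hm h => hm ?_
    simp only [h, zero_mul]
  · refine (finite_jetVariation v w b).subset fun m hm h => hm ?_
    simp only [h, mul_zero]

open Classical in
lemma jetVariation_gen (v v' : Var ι G) (m : Fin d → ℕ) (w : Density 𝕜 d ε η) :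
    jetVariation v w (gen 𝕜 _ (v', m)) = if v' = v then totalDerivs m w else 0 := by
  rw [jetVariation_apply]
  simp only [leftDeriv_gen]
  rw [finsum_eq_single _ m]
  · by_cases h : v' = v <;> simp [h]
  · intro n hn
    rw [if_neg, map_zero, mul_zero]
    intro h
    exact hn (Prod.ext_iff.1 h).2.symm

/-- With one factor held fixed, both sides are linear over X in the other, so `XLinear.ext` applies
to one argument after the other. -/
lemma bilinear_ext {s : ZMod 2} {D : Density 𝕜 d ε η →ₗ[𝕜] Density 𝕜 d ε η} (hD : XLinear D)
    (h : ∀ a b, D (PowerSeries.C a * PowerSeries.C b) = D (PowerSeries.C a) * PowerSeries.C b +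
      tw s (PowerSeries.C a) * D (PowerSeries.C b)) (f g : Density 𝕜 d ε η) :
    D (f * g) = D f * g + tw s f * D g := by
  have h1 : ∀ b, D ∘ₗ LinearMap.mulRight 𝕜 (PowerSeries.C b) =
      LinearMap.mulRight 𝕜 (PowerSeries.C b) ∘ₗ D +
        LinearMap.mulRight 𝕜 (D (PowerSeries.C b)) ∘ₗ tw s := fun b =>
    (hD.comp (xLinear_mulRight _)).ext (((xLinear_mulRight _).comp hD).add
      ((xLinear_mulRight _).comp (xLinear_mapCoeff _))) fun a => h a b
  have h2 : D ∘ₗ LinearMap.mulLeft 𝕜 f =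
      LinearMap.mulLeft 𝕜 (D f) + LinearMap.mulLeft 𝕜 (tw s f) ∘ₗ D :=
    (hD.comp (xLinear_mulLeft _)).ext ((xLinear_mulLeft _).add
      ((xLinear_mulLeft _).comp hD)) fun b => DFunLike.congr_fun (h1 b) f
  exact DFunLike.congr_fun h2 g

theorem isEvolutionary_variation {s : ZMod 2} {v : Var ι G} {w : Density 𝕜 d ε η}
    (hw : HasParity (v.parity ε η + s) w) : IsEvolutionary s (variation v w) := by
  have hX : XLinear (variation v w) := xLinear_extend _
  have hmul : ∀ f g, variation v w (f * g) = variation v w f * g + tw s f * variation v w g := by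
    refine bilinear_ext hX fun a b => ?_
    rw [← map_mul, variation, extend_C, extend_C, extend_C, jetVariation_mul hw, tw_C]
  have hone : variation v w 1 = 0 := by
    have h := hmul 1 1
    have h1 : tw s (1 : Density 𝕜 d ε η) = 1 := by
      rw [← _root_.map_one PowerSeries.C, tw_C, _root_.map_one]
    rw [h1, mul_one, mul_one, one_mul] at h
    simpa using h
  have hd1 : ∀ μ, totalDeriv μ (1 : Density 𝕜 d ε η) = 0 := by
    intro μ
    have h := totalDeriv_mul μ (1 : Density 𝕜 d ε η) 1
    simpa using h
  have ht1 : ∀ s, tw s (1 : Density 𝕜 d ε η) = 1 := by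
    intro s
    rw [← _root_.map_one PowerSeries.C, tw_C, _root_.map_one]
  refine ⟨hX, hmul, fun μ => DFunLike.congr_fun (f := variation v w ∘ₗ totalDeriv μ)
    (g := totalDeriv μ ∘ₗ variation v w) ?_, fun f => DFunLike.congr_fun
    (f := variation v w ∘ₗ tw 1) (g := sgn 𝕜 s • tw 1 ∘ₗ variation v w) ?_ f⟩
  · have hd : XLinear (totalDeriv (𝕜 := 𝕜) (ε := ε) (η := η) μ) := xLinear_mapCoeff _
    refine (hX.comp hd).ext_of_mul (hd.comp hX) ?_ (fun j => ?_) fun f g hf hg => ?_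
    · simp [hone, hd1]
    · simp only [LinearMap.comp_apply, totalDeriv, mapCoeff_C, jetTotalDeriv_gen]
      rw [variation, extend_C, extend_C, jetVariation_gen, jetVariation_gen]
      split_ifs
      · exact totalDerivs_add_single ..
      · simp
    · simp only [LinearMap.comp_apply] at hf hg ⊢
      simp only [hmul, totalDeriv_mul, map_add, hf, hg, totalDeriv_tw]
      abel
  · have ht : XLinear (tw (𝕜 := 𝕜) (d := d) (ε := ε) (η := η) 1) := xLinear_mapCoeff _
    refine (hX.comp ht).ext_of_mul ((ht.comp hX).smul _) ?_ (fun j => ?_) fun f g hf hg => ?_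
    · simp [hone, ht1]
    · simp only [LinearMap.comp_apply, LinearMap.smul_apply, tw_C, twist_gen, C_smul, map_smul]
      rw [variation, extend_C, jetVariation_gen]
      split_ifs with h
      · rw [(hw.totalDerivs _).tw_eq, smul_smul, ← h, one_mul, one_mul, sgn_add, mul_comm,
          mul_assoc, sgn_mul_self, mul_one]
      · simp
    · simp only [LinearMap.comp_apply, LinearMap.smul_apply] at hf hg ⊢
      simp only [hmul, tw_mul, map_add, hf, hg, tw_tw, smul_add, smul_mul_assoc, mul_smul_comm,
        add_comm s]

open Classical in
lemma variation_var (v v' : Var ι G) (w : Density 𝕜 d ε η) :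
    variation v w (var v') = if v' = v then w else 0 := by
  rw [variation, var, extend_C, jetVariation_gen]; simp

/-- Each derivative ∂^m acting on `w` is moved onto ∂f/∂(∂^m v) by parts, which produces the terms
of the functional derivative. -/
lemma variation_sub_mem (v : Var ι G) (w f : Density 𝕜 d ε η) :
    variation v w f - w * leftFun v f ∈ totalDerivatives 𝕜 d ε η := by
  have h1 := (((xLinear_mulLeft w).comp (xLinear_mapCoeff (jetLeftFun v))).smul (-1 : 𝕜)).add
    (xLinear_extend (jetVariation v w))
  have h2 := h1.eq_assemble f
  have h3 : variation v w f - w * leftFun v f = ((-1 : 𝕜) • LinearMap.mulLeft 𝕜 w ∘ₗ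
      mapCoeff (jetLeftFun v) + extend (jetVariation v w)) f := by
    simp only [LinearMap.add_apply, LinearMap.smul_apply, LinearMap.comp_apply,
      LinearMap.mulLeft_apply, variation, leftFun_eq_mapCoeff, neg_smul, one_smul]
    abel
  rw [h3, h2]
  -- The sum over m is finite only for each coefficient of `f`, so integration by parts is done
  -- order by order.
  refine assemble_mem_totalDerivatives fun n => ?_
  generalize PowerSeries.coeff n f = a
  simp only [LinearMap.add_apply, LinearMap.smul_apply, LinearMap.comp_apply,
    LinearMap.mulLeft_apply, extend_C, mapCoeff_C, neg_smul, one_smul]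
  rw [neg_add_eq_sub]
  let L : JetPoly 𝕜 d ε η →ₗ[𝕜] Density 𝕜 d ε η :=
    { toFun := fun a => w * PowerSeries.C a
      map_add' := by simp [mul_add]
      map_smul' := by simp [C_smul] }
  have h4 : w * PowerSeries.C (jetLeftFun v a) = ∑ᶠ m, L (jetLeftFunTerm v m a) :=
    map_jetLeftFun L v a
  rw [h4, jetVariation_apply, ← finsum_sub_distrib (finite_jetVariation v w a)]
  · refine finsum_induction _ (zero_mem _) (fun _ _ => add_mem) fun m => ?_
    convert totalDerivs_mul_sub_mem m w (PowerSeries.C (leftDeriv 𝕜 _ (v, m) a)) using 2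
    simp [L, jetLeftFunTerm, totalDerivs]
  · exact (finite_jetLeftFunTerm v a).subset fun m hm h => hm (by simp [h])

section FirstVariation

variable [Fintype ι] [Fintype G]

/-- The evolutionary vector field with components `u v`. -/
def vectorField (u : Var ι G → Density 𝕜 d ε η) : Density 𝕜 d ε η →ₗ[𝕜] Density 𝕜 d ε η :=
  sumLabels fun a => variation (.field a) (u (.field a)) + variation (.source a) (u (.source a))

theorem isEvolutionary_vectorField {s : ZMod 2} {u : Var ι G → Density 𝕜 d ε η}
    (hu : ∀ v, HasParity (v.parity ε η + s) (u v)) : IsEvolutionary s (vectorField u) :=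
  sumLabels_induction (P := IsEvolutionary s) .zero (fun _ _ => .add) fun _ =>
    (isEvolutionary_variation (hu _)).add (isEvolutionary_variation (hu _))

lemma vectorField_apply (u : Var ι G → Density 𝕜 d ε η) (f : Density 𝕜 d ε η) :
    vectorField u f = sumLabels fun a =>
      variation (.field a) (u (.field a)) f + variation (.source a) (u (.source a)) f := by
  simp only [vectorField, sumLabels, LinearMap.add_apply, LinearMap.sum_apply]

@[simp] lemma vectorField_var (u : Var ι G → Density 𝕜 d ε η) (v : Var ι G) :
    vectorField u (var v) = u v := by
  rw [vectorField_apply]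
  simp only [variation_var]
  cases v with
  | field b =>
    refine (congrArg sumLabels (funext fun a => ?_)).trans (sumLabels_ite (fun a => u (.field a)) b)
    by_cases h : b = a
    · subst h; simp
    · rw [if_neg fun h' => h (Var.field.inj h'), if_neg h]; simp
  | source b =>
    refine (congrArg sumLabels (funext fun a => ?_)).trans
      (sumLabels_ite (fun a => u (.source a)) b)
    by_cases h : b = a
    · subst h; simp
    · rw [if_neg fun h' => h (Var.source.inj h'), if_neg h]; simp

/-- The first variation formula. -/
theorem IsEvolutionary.integral_eq {s : ZMod 2} {D : Density 𝕜 d ε η →ₗ[𝕜] Density 𝕜 d ε η}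
    (hD : IsEvolutionary s D) (f : Density 𝕜 d ε η) :
    -- In the proof, `D` is first recognized as the sum of the elementary variations with its own
    -- components, by uniqueness; each of these is then integrated by parts.
    integral (D f) = integral (sumLabels fun a => D (fld a) * leftFun (.field a) f +
      D (src a) * leftFun (.source a) f) := by
  have h : D = vectorField fun v => D (var v) :=
    hD.ext (isEvolutionary_vectorField fun v => hD.hasParity (hasParity_var v)) fun v => by simp
  conv_lhs => rw [h]
  rw [vectorField_apply, integral_eq_iff, ← sumLabels_sub]
  refine sumLabels_induction (P := (· ∈ totalDerivatives 𝕜 d ε η)) (zero_mem _)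
    (fun _ _ => add_mem) fun a => ?_
  rw [add_sub_add_comm]
  exact add_mem (variation_sub_mem _ _ _) (variation_sub_mem _ _ _)

end FirstVariation

end Evolutionary

/-! ### Changes of variables and the chain rule -/

section Changes

variable {ι G : Type*} {𝕜 : Type*} [Field 𝕜] {d : ℕ} {ε : ι → ZMod 2} {η : G → ZMod 2}

lemma IsEvolutionary.map_mem {s : ZMod 2} {D : Density 𝕜 d ε η →ₗ[𝕜] Density 𝕜 d ε η}
    (hD : IsEvolutionary s D) {f : Density 𝕜 d ε η} (hf : f ∈ totalDerivatives 𝕜 d ε η) :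
    D f ∈ totalDerivatives 𝕜 d ε η := by
  obtain ⟨h, rfl⟩ := mem_totalDerivatives.1 hf
  rw [map_sum]
  exact sum_mem fun μ _ => hD.map_totalDeriv μ _ ▸ totalDeriv_mem _ _

lemma IsEvolutionary.integral_congr {s : ZMod 2} {D : Density 𝕜 d ε η →ₗ[𝕜] Density 𝕜 d ε η}
    (hD : IsEvolutionary s D) {f g : Density 𝕜 d ε η} (h : integral f = integral g) :
    integral (D f) = integral (D g) := by
  rw [integral_eq_iff, ← map_sub]
  exact hD.map_mem (integral_eq_iff.1 h)

namespace IsChangeOfVariables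

variable {T T' : Density 𝕜 d ε η ≃ₐ[𝕜] Density 𝕜 d ε η}

lemma symm (hT : IsChangeOfVariables T) : IsChangeOfVariables T.symm where
  map_param := by rw [AlgEquiv.symm_apply_eq, hT.map_param]
  map_totalDeriv μ f := by
    rw [AlgEquiv.symm_apply_eq, hT.map_totalDeriv, AlgEquiv.apply_symm_apply]
  map_parity f := by
    rw [AlgEquiv.symm_apply_eq, hT.map_parity, AlgEquiv.apply_symm_apply]

lemma trans (hT : IsChangeOfVariables T) (hT' : IsChangeOfVariables T') :
    IsChangeOfVariables (T.trans T') where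
  map_param := by simp [hT.map_param, hT'.map_param]
  map_totalDeriv μ f := by simp [hT.map_totalDeriv, hT'.map_totalDeriv]
  map_parity f := by simp [hT.map_parity, hT'.map_parity]

lemma xLinear (hT : IsChangeOfVariables T) : XLinear T.toLinearMap := fun f => by
  simp [hT.map_param]

lemma map_tw (hT : IsChangeOfVariables T) (s : ZMod 2) (f : Density 𝕜 d ε η) :
    T (tw s f) = tw s (T f) := by
  rcases zmod2_cases s with rfl | rfl
  · simp
  · rw [← parityMap_eq_tw, hT.map_parity, parityMap_eq_tw]

lemma hasParity (hT : IsChangeOfVariables T) {q : ZMod 2} {f : Density 𝕜 d ε η}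
    (hf : HasParity q f) : HasParity q (T f) := by
  rw [hasParity_iff, ← hT.map_tw, hasParity_iff.1 hf, map_smul]

lemma map_mem (hT : IsChangeOfVariables T) {f : Density 𝕜 d ε η}
    (hf : f ∈ totalDerivatives 𝕜 d ε η) : T f ∈ totalDerivatives 𝕜 d ε η := by
  obtain ⟨h, rfl⟩ := mem_totalDerivatives.1 hf
  rw [map_sum]
  exact sum_mem fun μ _ => hT.map_totalDeriv μ _ ▸ totalDeriv_mem _ _

lemma integral_congr (hT : IsChangeOfVariables T) {f g : Density 𝕜 d ε η}
    (h : integral f = integral g) : integral (T f) = integral (T g) := by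
  rw [integral_eq_iff, ← map_sub]
  exact hT.map_mem (integral_eq_iff.1 h)

/-- The same vector field read in the other coordinates; the conditions survive because `T` commutes
with total derivatives, parity and X. -/
lemma isEvolutionary_conj (hT : IsChangeOfVariables T) {s : ZMod 2}
    {D : Density 𝕜 d ε η →ₗ[𝕜] Density 𝕜 d ε η} (hD : IsEvolutionary s D) :
    IsEvolutionary s (T.symm.toLinearMap ∘ₗ D ∘ₗ T.toLinearMap) where
  xLinear := hT.symm.xLinear.comp (hD.xLinear.comp hT.xLinear)
  map_mul f g := by simp [hD.map_mul, ← hT.map_tw]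
  map_totalDeriv μ f := by
    simp [hD.map_totalDeriv, hT.map_totalDeriv, hT.symm.map_totalDeriv]
  map_tw f := by simp [hD.map_tw, hT.map_tw, hT.symm.map_tw]

variable [Fintype ι] [Fintype G]

/-- The chain rule for functional derivatives. -/
theorem integral_eq (hT : IsChangeOfVariables T) {s : ZMod 2}
    {D : Density 𝕜 d ε η →ₗ[𝕜] Density 𝕜 d ε η} (hD : IsEvolutionary s D) (f : Density 𝕜 d ε η) :
    integral (D (T f)) = integral (sumLabels fun a => D (T (fld a)) * T (leftFun (.field a) f) +
      D (T (src a)) * T (leftFun (.source a) f)) := by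
  -- First variation formula for the conjugated field T⁻¹DT, carried back by `T`.
  have h := hT.integral_congr ((hT.isEvolutionary_conj hD).integral_eq f)
  simpa [map_sumLabels] using h

end IsChangeOfVariables

/-- One of q, q + 1 is even. The paired factors in the bracket of even functionals are of this kind,
so they can be reordered without signs. -/
lemma HasParity.comm_of_opposite {q : ZMod 2} {f g : Density 𝕜 d ε η} (hf : HasParity q f)
    (hg : HasParity (q + 1) g) : f * g = g * f := by
  rw [hf.mul_comm hg, mul_add, zmod2_mul_self, mul_one, zmod2_add_self, sgn_zero, one_smul]

open Classical in
lemma leftFun_var_mul_var (v x y : Var ι G) :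
    leftFun v (var x * var y : Density 𝕜 d ε η) = (if x = v then var y else 0) +
      if y = v then sgn 𝕜 (v.parity ε η * x.parity ε η) • var x else 0 := by
  rw [leftFun_eq_mapCoeff, var, var, ← map_mul, mapCoeff_C, jetLeftFun_apply, finsum_eq_single _ 0]
  · simp only [jetLeftFunTerm, LinearMap.smul_apply, LinearMap.comp_apply, leftDeriv_mul,
      leftDeriv_gen, jetTotalDerivs_zero, twist_gen]
    by_cases hx : x = v <;> by_cases hy : y = v <;> simp [hx, hy, C_smul]
  · intro m hm
    have hm' : ∀ x, ¬(((x, 0) : Var ι G × (Fin d → ℕ)) = (v, m)) :=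
      fun x h => hm (Prod.ext_iff.1 h).2.symm
    simp [jetLeftFunTerm, leftDeriv_mul, hm']

end Changes

/-! ### Invariance of the antiparentheses -/

section Bracket

variable {ι G : Type*} [Fintype ι] [Fintype G] {𝕜 : Type*} [Field 𝕜] {d : ℕ}
  {ε : ι → ZMod 2} {η : G → ZMod 2}

/-- The second variation of a functional is symmetric. -/
lemma integral_second_variation {D D' : Density 𝕜 d ε η →ₗ[𝕜] Density 𝕜 d ε η}
    (hD : IsEvolutionary 1 D) (hD' : IsEvolutionary 1 D') (Q : Density 𝕜 d ε η) :
    integral (sumLabels fun a => sgn 𝕜 (a.parity ε η) •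
      (D' (fld a) * D (leftFun (.field a) Q) + D (fld a) * D' (leftFun (.field a) Q) -
        D' (src a) * D (leftFun (.source a) Q) - D (src a) * D' (leftFun (.source a) Q))) = 0 := by
  -- The variation of `Q` along DD' + D'D is computed in two ways: directly, and by applying each
  -- field to the first variation formula of the other. The terms with second-order components
  -- D(D'Φ), D(D'K) are common to both, so only the mixed terms survive.
  have h1 := (hD.anticomm hD').integral_eq Q
  have h2 := hD.integral_congr (hD'.integral_eq Q)
  have h3 := hD'.integral_congr (hD.integral_eq Q)
  rw [map_sumLabels] at h2 h3
  rw [LinearMap.add_apply, map_add, LinearMap.comp_apply, LinearMap.comp_apply, h2, h3, ← map_add,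
    ← sumLabels_add, ← sub_eq_zero, ← map_sub, ← sumLabels_sub, ← neg_eq_zero, ← map_neg] at h1
  refine Eq.trans ?_ h1
  congr 1
  rw [← sub_eq_zero, sub_neg_eq_add, ← sumLabels_add, ← sumLabels_zero (ι := ι) (G := G)]
  congr 1
  funext a
  have t : ∀ {D : Density 𝕜 d ε η →ₗ[𝕜] Density 𝕜 d ε η}, IsEvolutionary 1 D →
      tw 1 (D (fld a)) = -(sgn 𝕜 (a.parity ε η) • D (fld a)) ∧
        tw 1 (D (src a)) = sgn 𝕜 (a.parity ε η) • D (src a) := by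
    intro D hD
    refine ⟨?_, ?_⟩
    · rw [(hD.hasParity (hasParity_var _)).tw_eq, one_mul, sgn_add, sgn_one, mul_neg_one, neg_smul]
      rfl
    · rw [(hD.hasParity (hasParity_var _)).tw_eq, one_mul, sgn_add, Var.parity, sgn_add, sgn_one]
      simp
  simp only [map_add, hD.map_mul, hD'.map_mul, LinearMap.add_apply, LinearMap.comp_apply,
    (t hD).1, (t hD).2, (t hD').1, (t hD').2, add_mul, smul_add, smul_sub, density_neg_mul,
    smul_mul_assoc]
  abel

/-- The density of the antiparentheses. -/
def bracketDensity (f g : Density 𝕜 d ε η) : Density 𝕜 d ε η :=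
  sumLabels fun a => sgn 𝕜 (a.parity ε η) •
    (leftFun (.field a) f * leftFun (.source a) g + leftFun (.source a) f * leftFun (.field a) g)

/-- For even `f`, right and left derivatives differ by a sign depending on the variable alone. It is
opposite for a field and its source, which turns the minus of the bracket into a plus. -/
lemma antibracket_eq {f : Density 𝕜 d ε η} (hf : HasParity 0 f) (g : Density 𝕜 d ε η) :
    antibracket f g = integral (bracketDensity f g) := by
  unfold antibracket bracketDensity
  congr 2
  funext a
  rw [hf.rightFun_eq, hf.rightFun_eq]
  simp only [Var.parity, sgn_add, sgn_one, mul_neg_one, neg_smul, density_neg_mul, sub_neg_eq_add,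
    smul_add, smul_mul_assoc]

/-- The changes of variables that express functions of `Φ, K` (`N`) and of `Φ', K'` (`P`)
in the variables `Φ, K'`, for the canonical transformation generated by `∫ Φ K' + ∫ Q(Φ, K')`. -/
structure IsMixed (Q : Density 𝕜 d ε η) (N P : Density 𝕜 d ε η ≃ₐ[𝕜] Density 𝕜 d ε η) : Prop where
  left : IsChangeOfVariables N
  right : IsChangeOfVariables P
  left_fld : ∀ a, N (fld a) = fld a
  left_src : ∀ a, N (src a) = src a + leftFun (.field a) Q
  right_fld : ∀ a, P (fld a) = fld a + leftFun (.source a) Q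
  right_src : ∀ a, P (src a) = src a

/-- Invariance of the antiparentheses of even functionals. -/
theorem IsMixed.integral_bracketDensity {Q : Density 𝕜 d ε η}
    {N P : Density 𝕜 d ε η ≃ₐ[𝕜] Density 𝕜 d ε η} (h : IsMixed Q N P) (hQ : HasParity 1 Q)
    {f g f' g' : Density 𝕜 d ε η} (hf : HasParity 0 f) (hg : HasParity 0 g)
    (hf' : HasParity 0 f') (hg' : HasParity 0 g') (hff' : N f = P f') (hgg' : N g = P g') :
    integral (N (bracketDensity f g)) = integral (P (bracketDensity f' g')) := by
  -- A Hamiltonian-type vector field in mixed variables: the Φ-components come from the old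
  -- functional, the K'-components from the transformed one.
  let u : Density 𝕜 d ε η → Density 𝕜 d ε η → Var ι G → Density 𝕜 d ε η :=
    fun f f' v => match v with
    | .field a => sgn 𝕜 (a.parity ε η) • N (leftFun (.source a) f)
    | .source a => sgn 𝕜 (a.parity ε η) • P (leftFun (.field a) f')
  have pN : ∀ {f : Density 𝕜 d ε η}, HasParity 0 f → ∀ v,
      HasParity (v.parity ε η) (N (leftFun v f)) := by
    intro f hf v
    have := h.left.hasParity (hf.leftFun v)
    rwa [add_zero] at this
  have pP : ∀ {f : Density 𝕜 d ε η}, HasParity 0 f → ∀ v,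
      HasParity (v.parity ε η) (P (leftFun v f)) := by
    intro f hf v
    have := h.right.hasParity (hf.leftFun v)
    rwa [add_zero] at this
  have hu : ∀ {f f' : Density 𝕜 d ε η}, HasParity 0 f → HasParity 0 f' →
      IsEvolutionary 1 (vectorField (u f f')) := by
    intro f f' hf hf'
    refine isEvolutionary_vectorField fun v => ?_
    cases v with
    | field a => exact (pN hf _).smul _
    | source a =>
      refine HasParity.smul _ ?_
      rw [Var.parity, add_assoc, zmod2_add_self, add_zero]
      exact pP hf' (.field a)
  set D := vectorField (u f f') with hDdef
  set D' := vectorField (u g g') with hDdef'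
  have hD : IsEvolutionary 1 D := hu hf hf'
  have hD' : IsEvolutionary 1 D' := hu hg hg'
  have e1 := (h.left.integral_eq hD g).symm.trans
    ((congrArg (fun x => integral (D x)) hgg').trans (h.right.integral_eq hD g'))
  have e2 := (h.left.integral_eq hD' f).symm.trans
    ((congrArg (fun x => integral (D' x)) hff').trans (h.right.integral_eq hD' f'))
  have e3 := integral_second_variation hD hD' Q
  rw [← sub_eq_zero, ← map_sub, ← sumLabels_sub] at e1 e2
  -- `e1` and `e2` each supply half of both brackets; `e3` removes the terms D(δQ/δ·) and D'(δQ/δ·).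
  -- The products N(δg/δK)·P(δf'/δΦ'), and those with f and g exchanged, occur in both `e1` and `e2`
  -- with opposite signs.
  have e := congrArg₂ (· - ·) (congrArg₂ (· + ·) e1 e2) e3
  simp only [← map_add, ← sumLabels_add, ← map_sub, ← sumLabels_sub, add_zero, sub_zero] at e
  rw [← sub_eq_zero, ← map_sub]
  refine Eq.trans (congrArg integral ?_) e
  rw [bracketDensity, bracketDensity, map_sumLabels, map_sumLabels, ← sumLabels_sub]
  congr 1
  funext a
  have dN : ∀ f f', vectorField (u f f') (fld a) =
      sgn 𝕜 (a.parity ε η) • N (leftFun (.source a) f) := fun f f' => vectorField_var _ _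
  have dP : ∀ f f', vectorField (u f f') (src a) =
      sgn 𝕜 (a.parity ε η) • P (leftFun (.field a) f') := fun f f' => vectorField_var _ _
  have pQ : ∀ {D : Density 𝕜 d ε η →ₗ[𝕜] Density 𝕜 d ε η}, IsEvolutionary 1 D → ∀ v,
      HasParity (v.parity ε η) (D (leftFun v Q)) := by
    intro D hD v
    have := hD.hasParity (hQ.leftFun v)
    rwa [add_assoc, zmod2_add_self, add_zero] at this
  have hs : (.field a : Var ι G).parity ε η = (Var.source a).parity ε η + 1 := by
    rw [Var.parity, Var.parity, add_assoc, zmod2_add_self, add_zero]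
  have c1 := (pP hf' (.field a)).comm_of_opposite (pN hg (.source a))
  have c2 := (pP hg' (.field a)).comm_of_opposite (pN hf (.source a))
  have c3 := (pN hf (.field a)).comm_of_opposite (pN hg (.source a))
  have c4 := (pP hf' (.field a)).comm_of_opposite (pP hg' (.source a))
  have c9 := (pP hg' (.field a)).comm_of_opposite (pP hf' (.source a))
  have c5 := (pQ hD (.field a)).comm_of_opposite (pN hg (.source a))
  have c6 := (pQ hD' (.field a)).comm_of_opposite (pN hf (.source a))
  have c7 := (pQ hD (.source a)).comm_of_opposite (hs ▸ pP hg' (.field a))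
  have c8 := (pQ hD' (.source a)).comm_of_opposite (hs ▸ pP hf' (.field a))
  have ss : ∀ x : Density 𝕜 d ε η,
      sgn 𝕜 (a.parity ε η) • sgn 𝕜 (a.parity ε η) • x = x := by
    intro x
    rw [smul_smul, sgn_mul_self, one_smul]
  simp only [h.left_fld, h.left_src, h.right_fld, h.right_src, map_add, map_smul, map_mul, add_mul,
    smul_add, smul_sub, c5, c6, c7, c8]
  simp only [hDdef, hDdef', dN, dP, smul_mul_assoc, ss, c1, c2, c3, c4, c9]
  abel

lemma IsMixed.antibracket_eq_zero {Q : Density 𝕜 d ε η}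
    {N P : Density 𝕜 d ε η ≃ₐ[𝕜] Density 𝕜 d ε η} (h : IsMixed Q N P) (hQ : HasParity 1 Q)
    {f g f' g' : Density 𝕜 d ε η} (hf : HasParity 0 f) (hg : HasParity 0 g)
    (hf' : HasParity 0 f') (hg' : HasParity 0 g') (hff' : N f = P f') (hgg' : N g = P g')
    (h0 : antibracket f g = 0) : antibracket f' g' = 0 := by
  rw [antibracket_eq hf, integral_eq_zero_iff] at h0
  have h1 := h.integral_bracketDensity hQ hf hg hf' hg' hff' hgg'
  rw [integral_eq_zero_iff.2 (h.left.map_mem h0), eq_comm, integral_eq_zero_iff] at h1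
  rw [antibracket_eq hf', integral_eq_zero_iff]
  simpa using h.right.symm.map_mem h1

lemma leftFun_source_generating (Q : Density 𝕜 d ε η) (a : Label ι G) :
    leftFun (.source a) (generating Q) = fld a + leftFun (.source a) Q := by
  rw [generating, leftFun_add]
  congr 1
  rw [leftFun_eq_mapCoeff, map_sumLabels]
  refine (congrArg sumLabels (funext fun b => ?_)).trans (sumLabels_ite (fun b => fld b) a)
  rw [← leftFun_eq_mapCoeff, leftFun_var_mul_var]
  by_cases h : a = b
  · subst h
    -- The source derivative passes its own field without a sign, since one of the two is even.
    simp [Var.parity, add_mul, zmod2_mul_self, zmod2_add_self]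
  · rw [if_neg (by simp), if_neg fun h' => h (Var.source.inj h').symm, if_neg h, add_zero]

lemma leftFun_field_generating (Q : Density 𝕜 d ε η) (a : Label ι G) :
    leftFun (.field a) (generating Q) = src a + leftFun (.field a) Q := by
  rw [generating, leftFun_add]
  congr 1
  rw [leftFun_eq_mapCoeff, map_sumLabels]
  refine (congrArg sumLabels (funext fun b => ?_)).trans (sumLabels_ite (fun b => src b) a)
  rw [← leftFun_eq_mapCoeff, leftFun_var_mul_var]
  by_cases h : a = b
  · subst h
    simp
  · rw [if_neg fun h' => h (Var.field.inj h').symm, if_neg (by simp), if_neg h, add_zero]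

/-- N = M⁻¹ and P = M⁻¹ ∘ T. Applying M⁻¹ to the generating equations for K and Φ' solves them
explicitly in terms of Φ, K'. -/
theorem IsGeneratedBy.exists_isMixed {Q : Density 𝕜 d ε η}
    {T : Density 𝕜 d ε η ≃ₐ[𝕜] Density 𝕜 d ε η} (hT : IsGeneratedBy (generating Q) T) :
    ∃ N P : Density 𝕜 d ε η ≃ₐ[𝕜] Density 𝕜 d ε η, IsMixed Q N P ∧ ∀ f, P f = N (T f) := by
  obtain ⟨hT, M, hM, h1, h2, h3, h4⟩ := hT
  refine ⟨M.symm, T.trans M.symm, ⟨hM.symm, hT.trans hM.symm, fun a => ?_, fun a => ?_, fun a => ?_,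
    fun a => ?_⟩, fun f => rfl⟩
  · rw [AlgEquiv.symm_apply_eq, h1]
  · rw [AlgEquiv.symm_apply_eq, ← leftFun_field_generating]
    exact h4 a
  · rw [AlgEquiv.trans_apply, AlgEquiv.symm_apply_eq, ← leftFun_source_generating]
    exact h3 a
  · rw [AlgEquiv.trans_apply, AlgEquiv.symm_apply_eq, h2]

end Bracket

/-! ### Substitutions and dependence on a set of variables -/

section Substitutions

variable {ι G : Type*} {𝕜 : Type*} [Field 𝕜] {d : ℕ} {ε : ι → ZMod 2} {η : G → ZMod 2}

/-- Substitutions of densities for the variables, extended to their derivatives. -/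
structure IsSubstitution (L : Density 𝕜 d ε η →ₗ[𝕜] Density 𝕜 d ε η) : Prop where
  xLinear : XLinear L
  map_one : L 1 = 1
  map_mul : ∀ f g, L (f * g) = L f * L g
  map_totalDeriv : ∀ μ f, L (totalDeriv μ f) = totalDeriv μ (L f)

lemma IsChangeOfVariables.isSubstitution {T : Density 𝕜 d ε η ≃ₐ[𝕜] Density 𝕜 d ε η}
    (hT : IsChangeOfVariables T) : IsSubstitution T.toLinearMap :=
  ⟨hT.xLinear, by simp, by simp, hT.map_totalDeriv⟩

lemma IsSubstitution.id : IsSubstitution (LinearMap.id : Density 𝕜 d ε η →ₗ[𝕜] _) :=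
  ⟨fun _ => rfl, rfl, fun _ _ => rfl, fun _ _ => rfl⟩

lemma IsSubstitution.comp {L L' : Density 𝕜 d ε η →ₗ[𝕜] Density 𝕜 d ε η} (hL : IsSubstitution L)
    (hL' : IsSubstitution L') : IsSubstitution (L ∘ₗ L') where
  xLinear := hL.xLinear.comp hL'.xLinear
  map_one := by simp [hL.map_one, hL'.map_one]
  map_mul := by simp [hL.map_mul, hL'.map_mul]
  map_totalDeriv := by simp [hL.map_totalDeriv, hL'.map_totalDeriv]

lemma IsSubstitution.map_C_gen {L : Density 𝕜 d ε η →ₗ[𝕜] Density 𝕜 d ε η}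
    (hL : IsSubstitution L) (j : Var ι G × (Fin d → ℕ)) :
    L (PowerSeries.C (gen 𝕜 _ j)) = totalDerivs j.2 (L (var j.1)) := by
  rw [← map_totalDerivs hL.map_totalDeriv, totalDerivs_var]

theorem IsSubstitution.ext {L L' : Density 𝕜 d ε η →ₗ[𝕜] Density 𝕜 d ε η} (hL : IsSubstitution L)
    (hL' : IsSubstitution L') (h : ∀ v, L (var v) = L' (var v)) : L = L' := by
  refine hL.xLinear.ext_of_mul hL'.xLinear (by rw [hL.map_one, hL'.map_one]) (fun j => ?_) ?_
  · rw [hL.map_C_gen, hL'.map_C_gen, h]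
  · intro f g hf hg
    rw [hL.map_mul, hL'.map_mul, hf, hg]

/-- Images of the right parity supercommute, so they define an algebra map on polynomials. Its
extension is multiplicative by linearity over X in one factor at a time. -/
theorem exists_isSubstitution (u : Var ι G → Density 𝕜 d ε η)
    (hu : ∀ v, HasParity (v.parity ε η) (u v)) :
    ∃ L : Density 𝕜 d ε η →ₗ[𝕜] Density 𝕜 d ε η, IsSubstitution L ∧ ∀ v, L (var v) = u v := by
  let φ : JetPoly 𝕜 d ε η →ₐ[𝕜] Density 𝕜 d ε η := lift 𝕜 _ (fun j => totalDerivs j.2 (u j.1))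
    fun x y => ((hu x.1).totalDerivs _).mul_comm ((hu y.1).totalDerivs _)
  have hφ : ∀ j, φ (gen 𝕜 _ j) = totalDerivs j.2 (u j.1) := fun j => lift_gen ..
  have hX : XLinear (extend φ.toLinearMap) := xLinear_extend _
  have h1 : extend φ.toLinearMap (1 : Density 𝕜 d ε η) = 1 := by
    rw [← map_one PowerSeries.C, extend_C]; simp
  have hmul : ∀ f g, extend φ.toLinearMap (f * g) =
      extend φ.toLinearMap f * extend φ.toLinearMap g := by
    intro f g
    have e1 : ∀ b, extend φ.toLinearMap ∘ₗ LinearMap.mulRight 𝕜 (PowerSeries.C b) =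
        LinearMap.mulRight 𝕜 (φ b) ∘ₗ extend φ.toLinearMap := fun b =>
      (hX.comp (xLinear_mulRight _)).ext ((xLinear_mulRight _).comp hX) fun a => by
        simp only [LinearMap.comp_apply, LinearMap.mulRight_apply]
        rw [← map_mul, extend_C, extend_C]
        simp
    have e2 : extend φ.toLinearMap ∘ₗ LinearMap.mulLeft 𝕜 f =
        LinearMap.mulLeft 𝕜 (extend φ.toLinearMap f) ∘ₗ extend φ.toLinearMap :=
      (hX.comp (xLinear_mulLeft _)).ext ((xLinear_mulLeft _).comp hX) fun b => by
        have := DFunLike.congr_fun (e1 b) f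
        simpa using this
    exact DFunLike.congr_fun e2 g
  refine ⟨extend φ.toLinearMap, ⟨hX, h1, hmul, fun μ => ?_⟩, fun v => ?_⟩
  · have hd : XLinear (totalDeriv (𝕜 := 𝕜) (ε := ε) (η := η) μ) := xLinear_mapCoeff _
    refine DFunLike.congr_fun (f := extend φ.toLinearMap ∘ₗ totalDeriv μ)
      (g := totalDeriv μ ∘ₗ extend φ.toLinearMap) ?_
    have hd1 : totalDeriv μ (1 : Density 𝕜 d ε η) = 0 := by
      simpa using totalDeriv_mul μ (1 : Density 𝕜 d ε η) 1
    refine (hX.comp hd).ext_of_mul (hd.comp hX) ?_ (fun j => ?_) fun f g hf hg => ?_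
    · rw [LinearMap.comp_apply, LinearMap.comp_apply, h1, hd1, map_zero]
    · simp only [LinearMap.comp_apply, totalDeriv, mapCoeff_C, jetTotalDeriv_gen]
      rw [extend_C, extend_C]
      simp only [AlgHom.toLinearMap_apply, hφ]
      exact totalDerivs_add_single ..
    · simp only [LinearMap.comp_apply] at hf hg ⊢
      rw [totalDeriv_mul, map_add, hmul, hmul, hmul, totalDeriv_mul, hf, hg]
  · rw [var, extend_C]
    simp [hφ]

/-- The density `f` contains only the variables in `S` and their derivatives. -/
def InVars (S : Set (Var ι G)) (f : Density 𝕜 d ε η) : Prop :=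
  ∀ n, PowerSeries.coeff n f ∈ Algebra.adjoin 𝕜 (gen 𝕜 _ '' {j | j.1 ∈ S})

namespace InVars

variable {S : Set (Var ι G)} {f g : Density 𝕜 d ε η}

lemma univ (f : Density 𝕜 d ε η) : InVars Set.univ f := by
  intro n
  generalize PowerSeries.coeff n f = a
  induction a using SuperPoly.induction with
  | h0 c => exact Subalgebra.algebraMap_mem _ c
  | h1 j => exact Algebra.subset_adjoin (Set.mem_image_of_mem _ trivial)
  | hadd a b ha hb => exact add_mem ha hb
  | hmul a b ha hb => exact mul_mem ha hb

lemma zero : InVars S (0 : Density 𝕜 d ε η) := fun n => by simp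

lemma add (hf : InVars S f) (hg : InVars S g) : InVars S (f + g) := fun n => by
  rw [map_add]; exact add_mem (hf n) (hg n)

lemma smul (c : 𝕜) (hf : InVars S f) : InVars S (c • f) := fun n => by
  rw [PowerSeries.coeff_smul]; exact Subalgebra.smul_mem _ (hf n) c

lemma mul (hf : InVars S f) (hg : InVars S g) : InVars S (f * g) := fun n => by
  rw [PowerSeries.coeff_mul]; exact sum_mem fun p _ => mul_mem (hf _) (hg _)

lemma C {a : JetPoly 𝕜 d ε η} (ha : a ∈ Algebra.adjoin 𝕜 (gen 𝕜 _ '' {j | j.1 ∈ S})) :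
    InVars S (PowerSeries.C a : Density 𝕜 d ε η) := fun n => by
  rw [PowerSeries.coeff_C]
  split_ifs
  · exact ha
  · exact zero_mem _

lemma var {v : Var ι G} (hv : v ∈ S) : InVars S (var v : Density 𝕜 d ε η) :=
  C (Algebra.subset_adjoin (Set.mem_image_of_mem _ hv))

lemma totalDerivs (hf : InVars S f) (m : Fin d → ℕ) : InVars S (totalDerivs m f) := fun n => by
  rw [BV.totalDerivs, coeff_mapCoeff]; exact jetTotalDerivs_mem_adjoin m (hf n)

lemma leftFun (hf : InVars S f) (v : Var ι G) : InVars S (leftFun v f) := fun n => by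
  rw [leftFun_eq_mapCoeff, coeff_mapCoeff]; exact jetLeftFun_mem_adjoin v (hf n)

lemma leftFun_eq_zero (hf : InVars S f) {v : Var ι G} (hv : v ∉ S) : BV.leftFun v f = 0 := by
  ext n
  rw [leftFun_eq_mapCoeff, coeff_mapCoeff, jetLeftFun_eq_zero_of_mem_adjoin hv (hf n), map_zero]

lemma assemble {h : ℕ → Density 𝕜 d ε η} (hh : ∀ n, InVars S (h n)) : InVars S (assemble h) :=
  fun n => by
    rw [BV.assemble, PowerSeries.coeff_mk]; exact sum_mem fun p _ => hh _ _

end InVars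

lemma IsSubstitution.inVars {S S' : Set (Var ι G)} {L : Density 𝕜 d ε η →ₗ[𝕜] Density 𝕜 d ε η}
    (hL : IsSubstitution L) (h : ∀ v ∈ S, InVars S' (L (var v))) {f : Density 𝕜 d ε η}
    (hf : InVars S f) : InVars S' (L f) := by
  rw [hL.xLinear.eq_assemble]
  refine InVars.assemble fun n => ?_
  have hn := hf n
  generalize PowerSeries.coeff n f = a at hn ⊢
  induction hn using Algebra.adjoin_induction with
  | mem a ha =>
    obtain ⟨j, hj, rfl⟩ := ha
    rw [hL.map_C_gen]
    exact (h _ hj).totalDerivs _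
  | algebraMap c =>
    rw [C_algebraMap, map_smul, hL.map_one]
    exact (InVars.C (one_mem _)).smul c
  | add a b _ _ ha hb => rw [map_add, map_add]; exact ha.add hb
  | mul a b _ _ ha hb => rw [_root_.map_mul, hL.map_mul]; exact ha.mul hb

lemma IsSubstitution.eq_of_inVars {S : Set (Var ι G)}
    {L L' : Density 𝕜 d ε η →ₗ[𝕜] Density 𝕜 d ε η} (hL : IsSubstitution L)
    (hL' : IsSubstitution L') (h : ∀ v ∈ S, L (BV.var v) = L' (BV.var v)) {f : Density 𝕜 d ε η}
    (hf : InVars S f) : L f = L' f := by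
  rw [hL.xLinear.eq_assemble, hL'.xLinear.eq_assemble]
  congr 1
  funext n
  have hn := hf n
  generalize PowerSeries.coeff n f = a at hn ⊢
  induction hn using Algebra.adjoin_induction with
  | mem a ha =>
    obtain ⟨j, hj, rfl⟩ := ha
    rw [hL.map_C_gen, hL'.map_C_gen, h _ hj]
  | algebraMap c => rw [C_algebraMap, map_smul, map_smul, hL.map_one, hL'.map_one]
  | add a b _ _ ha hb => rw [map_add, map_add, map_add, ha, hb]
  | mul a b _ _ ha hb => rw [_root_.map_mul, hL.map_mul, hL'.map_mul, ha, hb]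

/-- If a change of variables shifts all variables by functions of the variables in `S`, then the
inverse change of variables preserves the functions of the variables in `S`. -/
theorem IsChangeOfVariables.inVars_symm {S : Set (Var ι G)}
    {T : Density 𝕜 d ε η ≃ₐ[𝕜] Density 𝕜 d ε η} (hT : IsChangeOfVariables T)
    {q : Var ι G → Density 𝕜 d ε η} (hq : ∀ v, InVars S (q v))
    (hTq : ∀ v, T (var v) = var v + q v) {f : Density 𝕜 d ε η} (hf : InVars S f) :
    InVars S (T.symm f) := by
  classical
  have hp : ∀ v, HasParity (v.parity ε η) (q v) := by
    intro v
    have h1 : q v = T (var v) + -var v := by rw [hTq]; abel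
    rw [h1]
    exact (hT.hasParity (hasParity_var v)).add (hasParity_var v).neg
  -- `L` restricts to v = 0 outside `S`, and `L'` to v = −q(v) outside `S`, which is the same locus
  -- seen through v ↦ v + q(v). Hence T L = L' T.
  obtain ⟨L, hL, hLv⟩ := exists_isSubstitution (𝕜 := 𝕜) (d := d) (ε := ε) (η := η)
    (fun v => if v ∈ S then var v else 0) fun v => by
      split_ifs
      · exact hasParity_var v
      · exact hasParity_zero _
  obtain ⟨L', hL', hLv'⟩ := exists_isSubstitution (𝕜 := 𝕜) (d := d) (ε := ε) (η := η)
    (fun v => if v ∈ S then var v else -q v) fun v => by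
      split_ifs
      · exact hasParity_var v
      · exact (hp v).neg
  have hid : ∀ {g}, InVars S g → L' g = g := fun hg =>
    hL'.eq_of_inVars .id (fun v hv => by simp [hLv', hv]) hg
  have hcomp : T.toLinearMap ∘ₗ L = L' ∘ₗ T.toLinearMap := by
    refine (hT.isSubstitution.comp hL).ext (hL'.comp hT.isSubstitution) fun v => ?_
    simp only [LinearMap.comp_apply, AlgEquiv.toLinearMap_apply, hLv, hTq, map_add, hLv',
      hid (hq v)]
    split_ifs
    · exact hTq v
    · rw [map_zero, neg_add_cancel]
  -- Since `L'` fixes functions of `S`, T L T⁻¹ f = L' f = f. Thus T⁻¹ f = L T⁻¹ f lies in the image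
  -- of `L`, which involves only `S`.
  have h1 : T (L (T.symm f)) = f := by
    have := DFunLike.congr_fun hcomp (T.symm f)
    simpa [hid hf] using this
  rw [T.symm_apply_eq.2 h1.symm]
  refine hL.inVars (fun v _ => ?_) (InVars.univ _)
  rw [hLv]
  split_ifs with hv
  · exact InVars.var hv
  · exact InVars.zero

lemma independent_iff {f : Density 𝕜 d ε η} : IndependentOfBgGhostsAndSources f ↔
    ∃ g : Density 𝕜 d ε η, integral f = integral g ∧ InVars {v | v.IsQuantum} g := by
  have h : {x : JetPoly 𝕜 d ε η | ∃ (v : Var ι G) (m : Fin d → ℕ),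
      v.IsQuantum ∧ x = gen 𝕜 _ (v, m)} = gen 𝕜 _ '' {j | j.1 ∈ {v : Var ι G | v.IsQuantum}} := by
    ext x
    constructor
    · rintro ⟨v, m, hv, rfl⟩
      exact ⟨(v, m), hv, rfl⟩
    · rintro ⟨j, hj, rfl⟩
      exact ⟨j.1, j.2, hj, rfl⟩
  rw [IndependentOfBgGhostsAndSources, h]
  rfl

/-- T⁻¹ = P⁻¹ N, and all shifts in N and P are functional derivatives of Q, hence functions of the
quantum variables. -/
theorem independent_symm {Q : Density 𝕜 d ε η} (hQ : IndependentOfBgGhostsAndSources Q)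
    {T : Density 𝕜 d ε η ≃ₐ[𝕜] Density 𝕜 d ε η} (hT : IsChangeOfVariables T)
    {N P : Density 𝕜 d ε η ≃ₐ[𝕜] Density 𝕜 d ε η} (h : IsMixed Q N P) (hP : ∀ f, P f = N (T f))
    {f : Density 𝕜 d ε η} (hf : IndependentOfBgGhostsAndSources f) :
    IndependentOfBgGhostsAndSources (T.symm f) := by
  obtain ⟨q, hq, hqS⟩ := independent_iff.1 hQ
  obtain ⟨g, hg, hgS⟩ := independent_iff.1 hf
  refine independent_iff.2 ⟨T.symm g, hT.symm.integral_congr hg, ?_⟩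
  have hqv : ∀ v, InVars {v | v.IsQuantum} (leftFun v Q) := fun v => by
    rw [leftFun_congr hq]; exact hqS.leftFun v
  have h1 : T.symm g = P.symm (N g) := by
    rw [eq_comm, AlgEquiv.symm_apply_eq, hP, AlgEquiv.apply_symm_apply]
  rw [h1]
  refine h.right.inVars_symm (q := fun v => match v with
    | .field a => leftFun (.source a) Q
    | .source _ => 0) ?_ ?_ (h.left.isSubstitution.inVars ?_ hgS)
  · rintro (a | a)
    · exact hqv _
    · exact InVars.zero
  · rintro (a | a)
    · exact h.right_fld a
    · exact (h.right_src a).trans (add_zero _).symm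
  · rintro (a | a) ha
    · exact (h.left_fld a).symm ▸ InVars.var ha
    · exact (h.left_src a).symm ▸ (InVars.var ha).add (hqv _)

end Substitutions

/-! ### Invariance of the background action -/

section Background

variable {ι G : Type*} {𝕜 : Type*} [Field 𝕜] {d : ℕ} {ε : ι → ZMod 2} {η : G → ZMod 2}

lemma twist_jetSubst (s : ZMod 2) (σ : Var ι G → List (Var ι G))
    (hσ : ∀ v, ∀ w ∈ σ v, w.parity ε η = v.parity ε η) (f : JetPoly 𝕜 d ε η) :
    jetSubst σ hσ (twist s f) = twist s (jetSubst σ hσ f) := by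
  induction f using SuperPoly.induction with
  | h0 c => simp
  | h1 j =>
    have h : ∀ l : List (Var ι G), (∀ w ∈ l, w.parity ε η = j.1.parity ε η) →
        sgn 𝕜 (s * j.1.parity ε η) • (l.map fun w => (gen 𝕜 _ (w, j.2) : JetPoly 𝕜 d ε η)).sum =
          twist s (l.map fun w => gen 𝕜 _ (w, j.2)).sum := by
      intro l hl
      induction l with
      | nil => simp
      | cons a l ih =>
        simp only [List.map_cons, List.sum_cons, smul_add, map_add, twist_gen]
        rw [ih fun w hw => hl w (List.mem_cons_of_mem _ hw), hl a List.mem_cons_self]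
    simpa [jetSubst] using h _ (hσ j.1)
  | hadd f g hf hg => simp [hf, hg]
  | hmul f g hf hg => simp [hf, hg]

lemma hasParity_jetSubst {q : ZMod 2} {f : Density 𝕜 d ε η} (hf : HasParity q f)
    (σ : Var ι G → List (Var ι G)) (hσ : ∀ v, ∀ w ∈ σ v, w.parity ε η = v.parity ε η) :
    HasParity q (mapCoeff (jetSubst σ hσ).toLinearMap f) := by
  have h : tw 1 (mapCoeff (jetSubst σ hσ).toLinearMap f) =
      mapCoeff (jetSubst σ hσ).toLinearMap (tw 1 f) := by
    ext n
    simp [tw, twist_jetSubst]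
  rw [hasParity_iff, h, hasParity_iff.1 hf, map_smul]

lemma HasParity.sub {q : ZMod 2} {f g : Density 𝕜 d ε η} (hf : HasParity q f)
    (hg : HasParity q g) : HasParity q (f - g) := by
  rw [hasParity_iff, map_sub, hasParity_iff.1 hf, hasParity_iff.1 hg, smul_sub]

lemma HasParity.matterPart {q : ZMod 2} {f : Density 𝕜 d ε η} (hf : HasParity q f) :
    HasParity q (matterPart f) :=
  ((hasParity_jetSubst hf _ _).sub (hasParity_jetSubst hf _ _)).sub (hasParity_jetSubst hf _ _)

lemma hasParity_background (R : GaugeTransformations 𝕜 d ε η) (a : Label ι G) :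
    HasParity (a.parity ε η + 1) (R.background a) := by
  have h : ∀ I, η I + 1 + 1 = η I := fun I => by rw [add_assoc, zmod2_add_self, add_zero]
  cases a with
  | phys i => exact (R.Rphys_parity i).matterPart
  | ghost I => exact (h I).symm ▸ (R.Rghost_parity I).matterPart
  | antighost I => exact (h I).symm ▸ hasParity_jetSubst (R.Rantighost_parity I) _ _
  | lagrange I => exact hasParity_jetSubst (R.Rlagrange_parity I) _ _
  | bgPhys i => exact hasParity_jetSubst (R.Rphys_parity i) _ _
  | bgGhost I => exact (h I).symm ▸ hasParity_jetSubst (R.Rghost_parity I) _ _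

lemma hasParity_backgroundAction [Fintype ι] [Fintype G] (R : GaugeTransformations 𝕜 d ε η) :
    HasParity 0 (backgroundAction R) := by
  refine HasParity.neg (sumLabels_induction (P := HasParity 0) (hasParity_zero _)
    (fun _ _ => HasParity.add) fun a => ?_)
  have h := (hasParity_background R a).mul (hasParity_var (𝕜 := 𝕜) (d := d) (.source a))
  rwa [Var.parity, zmod2_add_self] at h

variable (𝕜 d ε η) in
/-- Polynomials in the fields that are linear in the background fields, or bilinear in the fields
and the background fields. -/
def backgroundForms : Submodule 𝕜 (JetPoly 𝕜 d ε η) :=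
  Submodule.span 𝕜 ({x | ∃ (b : Label ι G) (m : Fin d → ℕ), b.IsBackground ∧
      x = gen 𝕜 _ (.field b, m)} ∪
    {x | ∃ (a b : Label ι G) (m n : Fin d → ℕ), b.IsBackground ∧
      x = gen 𝕜 _ (.field a, m) * gen 𝕜 _ (.field b, n)})

lemma gen_mem_backgroundForms {b : Label ι G} (hb : b.IsBackground) (m : Fin d → ℕ) :
    gen 𝕜 _ (.field b, m) ∈ backgroundForms 𝕜 d ε η :=
  Submodule.subset_span (Or.inl ⟨b, m, hb, rfl⟩)

lemma gen_mul_mem_backgroundForms (a : Label ι G) {b : Label ι G} (hb : b.IsBackground)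
    (m n : Fin d → ℕ) :
    gen 𝕜 _ (.field a, m) * gen 𝕜 _ (.field b, n) ∈ backgroundForms 𝕜 d ε η :=
  Submodule.subset_span (Or.inr ⟨a, b, m, n, hb, rfl⟩)

lemma mul_gen_mem_backgroundForms (a : Label ι G) {b : Label ι G} (hb : b.IsBackground)
    (m n : Fin d → ℕ) :
    gen 𝕜 _ (.field b, m) * gen 𝕜 _ (.field a, n) ∈ backgroundForms 𝕜 d ε η := by
  rw [gen_comm]
  exact Submodule.smul_mem _ _ (gen_mul_mem_backgroundForms a hb n m)

lemma coeff_mem_of_span {W V : Submodule 𝕜 (JetPoly 𝕜 d ε η)}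
    {F : Density 𝕜 d ε η → Density 𝕜 d ε η} {L : JetPoly 𝕜 d ε η →ₗ[𝕜] JetPoly 𝕜 d ε η}
    (hF : ∀ f n, PowerSeries.coeff n (F f) = L (PowerSeries.coeff n f)) (hL : W ≤ V.comap L)
    {f : Density 𝕜 d ε η} (hf : ∀ n, PowerSeries.coeff n f ∈ W) (n : ℕ) :
    PowerSeries.coeff n (F f) ∈ V := by
  rw [hF]; exact hL (hf n)

/-- The action of `matterPart` on polynomials. -/
def jetMatterPart : JetPoly 𝕜 d ε η →ₗ[𝕜] JetPoly 𝕜 d ε η where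
  toFun x := PowerSeries.coeff 0 (matterPart (PowerSeries.C x : Density 𝕜 d ε η))
  map_add' x y := by
    simp only [matterPart, map_add, map_sub]
    abel
  map_smul' c x := by
    simp only [matterPart, C_smul, map_smul, map_sub, PowerSeries.coeff_smul, smul_sub,
      RingHom.id_apply]

lemma coeff_matterPart (f : Density 𝕜 d ε η) (n : ℕ) :
    PowerSeries.coeff n (matterPart f) = jetMatterPart (PowerSeries.coeff n f) := by
  simp only [matterPart, jetMatterPart, LinearMap.coe_mk, AddHom.coe_mk, shiftAll, toBackground,
    shiftPhys, map_sub, coeff_mapCoeff, PowerSeries.coeff_zero_C]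

/-- In `matterPart` the linear term gives (C + C̲) − C̲ − C = 0. A term φC leaves (φ + φ̲)(C + C̲) −
φ̲C̲ − (φ + φ̲)C = φC̲, and a term CC' leaves CC̲' + C̲C'. This is where the assumed degrees of the
gauge transformations enter. -/
lemma coeff_background_mem (R : GaugeTransformations 𝕜 d ε η) (a : Label ι G) (n : ℕ) :
    PowerSeries.coeff n (R.background a) ∈ backgroundForms 𝕜 d ε η := by
  have bG : ∀ I : G, (Label.bgGhost I : Label ι G).IsBackground := fun _ => trivial
  cases a with
  | phys i =>
    refine coeff_mem_of_span coeff_matterPart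
      (sup_le (Submodule.span_le.2 ?_) (Submodule.span_le.2 ?_)) (R.Rphys_mem i) n
    · rintro _ ⟨I, m, rfl⟩
      simp [jetMatterPart, matterPart, shiftAll, toBackground, shiftPhys, jetSubst]
    · rintro _ ⟨A, m, I, k, rfl⟩
      have h := gen_mul_mem_backgroundForms (𝕜 := 𝕜) (ε := ε) (η := η) (.phys A) (bG I) m k
      rw [SetLike.mem_coe, Submodule.mem_comap]
      convert h using 1
      simp [jetMatterPart, matterPart, shiftAll, toBackground, shiftPhys, jetSubst, add_mul,
        mul_add]
      abel
  | ghost I =>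
    refine coeff_mem_of_span coeff_matterPart (Submodule.span_le.2 ?_) (R.Rghost_mem I) n
    rintro _ ⟨A, m, I, k, rfl⟩
    have h := add_mem (gen_mul_mem_backgroundForms (𝕜 := 𝕜) (ε := ε) (η := η) (.ghost A) (bG I) m k)
      (mul_gen_mem_backgroundForms (.ghost I) (bG A) m k)
    rw [SetLike.mem_coe, Submodule.mem_comap]
    convert h using 1
    simp [jetMatterPart, matterPart, shiftAll, toBackground, shiftPhys, jetSubst, add_mul, mul_add]
    abel
  | antighost I =>
    refine coeff_mem_of_span (fun f n => coeff_mapCoeff _ n f) (Submodule.span_le.2 ?_)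
      (R.Rantighost_mem I) n
    rintro _ ⟨A, m, I, k, rfl⟩
    simpa [jetSubst] using gen_mul_mem_backgroundForms (.antighost A) (bG I) m k
  | lagrange I =>
    refine coeff_mem_of_span (fun f n => coeff_mapCoeff _ n f) (Submodule.span_le.2 ?_)
      (R.Rlagrange_mem I) n
    rintro _ ⟨A, m, I, k, rfl⟩
    simpa [jetSubst] using gen_mul_mem_backgroundForms (.lagrange A) (bG I) m k
  | bgPhys i =>
    refine coeff_mem_of_span (fun f n => coeff_mapCoeff _ n f)
      (sup_le (Submodule.span_le.2 ?_) (Submodule.span_le.2 ?_)) (R.Rphys_mem i) n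
    · rintro _ ⟨I, m, rfl⟩
      simpa [jetSubst] using gen_mem_backgroundForms (bG I) m
    · rintro _ ⟨A, m, I, k, rfl⟩
      simpa [jetSubst] using gen_mul_mem_backgroundForms (.bgPhys A) (bG I) m k
  | bgGhost I =>
    refine coeff_mem_of_span (fun f n => coeff_mapCoeff _ n f) (Submodule.span_le.2 ?_)
      (R.Rghost_mem I) n
    rintro _ ⟨A, m, I, k, rfl⟩
    simpa [jetSubst] using gen_mul_mem_backgroundForms (.bgGhost A) (bG I) m k

/-- Densities on which the substitution `L` has the first-order expansion `1 + D`. -/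
def affineDensities (L D : Density 𝕜 d ε η →ₗ[𝕜] Density 𝕜 d ε η) :
    Submodule 𝕜 (Density 𝕜 d ε η) := LinearMap.ker (L - LinearMap.id - D)

section Affine

variable {L D : Density 𝕜 d ε η →ₗ[𝕜] Density 𝕜 d ε η}

lemma mem_affineDensities {f : Density 𝕜 d ε η} : f ∈ affineDensities L D ↔ L f = f + D f := by
  simp [affineDensities, sub_sub, sub_eq_zero]

lemma mem_affineDensities_of_coeff (hL : XLinear L) (hD : XLinear D) {f : Density 𝕜 d ε η}
    (h : ∀ n, PowerSeries.C (PowerSeries.coeff n f) ∈ affineDensities L D) :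
    f ∈ affineDensities L D := by
  have h1 : XLinear (L - LinearMap.id - D) := fun f => by
    simp only [LinearMap.sub_apply, hL f, hD f, mul_sub, LinearMap.id_apply]
  rw [affineDensities, LinearMap.mem_ker, h1.eq_assemble]
  have h2 : ∀ n, (L - LinearMap.id - D : Density 𝕜 d ε η →ₗ[𝕜] Density 𝕜 d ε η)
      (PowerSeries.C (PowerSeries.coeff n f)) = 0 := h
  simp only [h2, assemble_zero]

/-- If only one factor is shifted, no term of second order arises. -/
lemma mul_mem_affineDensities (hL : IsSubstitution L) (hD : IsEvolutionary 0 D)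
    {f c : Density 𝕜 d ε η} (hf : f ∈ affineDensities L D) (hc : L c = c) (hc' : D c = 0) :
    f * c ∈ affineDensities L D := by
  rw [mem_affineDensities] at hf ⊢
  rw [hL.map_mul, hD.map_mul, hf, hc, hc', mul_zero, add_zero, add_mul]

lemma C_gen_mem_affineDensities (hL : IsSubstitution L) (hD : IsEvolutionary 0 D) {v : Var ι G}
    (hv : var v ∈ affineDensities L D) (m : Fin d → ℕ) :
    PowerSeries.C (gen 𝕜 _ (v, m)) ∈ affineDensities L D := by
  rw [mem_affineDensities] at hv ⊢
  rw [← totalDerivs_var, map_totalDerivs hL.map_totalDeriv, hv, map_add,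
    map_totalDerivs hD.map_totalDeriv]

lemma background_mem_affineDensities (hL : IsSubstitution L) (hD : IsEvolutionary 0 D)
    (h : ∀ a, fld a ∈ affineDensities L D) (hb : ∀ b, b.IsBackground → D (fld b) = 0)
    (R : GaugeTransformations 𝕜 d ε η) (a : Label ι G) :
    R.background a ∈ affineDensities L D := by
  refine mem_affineDensities_of_coeff hL.xLinear hD.xLinear fun n => ?_
  have hn := coeff_background_mem R a n
  generalize PowerSeries.coeff n (R.background a) = x at hn ⊢
  induction hn using Submodule.span_induction with
  | mem x hx =>
    rcases hx with ⟨b, m, hb, rfl⟩ | ⟨a, b, m, k, hbb, rfl⟩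
    · exact C_gen_mem_affineDensities hL hD (h b) m
    · rw [map_mul]
      have h1 : D (PowerSeries.C (gen 𝕜 _ (.field b, k))) = 0 := by
        rw [← totalDerivs_var, map_totalDerivs hD.map_totalDeriv]
        exact (congrArg _ (hb b hbb)).trans (map_zero _)
      refine mul_mem_affineDensities hL hD (C_gen_mem_affineDensities hL hD (h a) m) ?_ h1
      rw [mem_affineDensities.1 (C_gen_mem_affineDensities hL hD (h b) k), h1, add_zero]
  | zero => rw [map_zero]; exact zero_mem _
  | add x y _ _ hx hy => rw [map_add]; exact add_mem hx hy
  | smul c x _ hx => rw [C_smul]; exact Submodule.smul_mem _ _ hx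

end Affine

lemma leftFun_eq_zero_of_not_isQuantum {Q : Density 𝕜 d ε η}
    (hQ : IndependentOfBgGhostsAndSources Q) {v : Var ι G} (hv : ¬ v.IsQuantum) :
    leftFun v Q = 0 := by
  obtain ⟨q, hq, hqS⟩ := independent_iff.1 hQ
  rw [leftFun_congr hq]
  exact hqS.leftFun_eq_zero hv

variable [Fintype ι] [Fintype G]

/-- P shifts only one factor of each monomial, as background fields and sources stay fixed; N shifts
only the source. Both expansions are therefore exact at first order, and the difference of the
first-order terms is ⟦S̄, Q⟧ up to total derivatives. -/
theorem integral_backgroundAction (R : GaugeTransformations 𝕜 d ε η) {Q : Density 𝕜 d ε η}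
    (hQ1 : HasParity 1 Q) (hQ : IndependentOfBgGhostsAndSources Q)
    (hR : antibracket (backgroundAction R) Q = 0)
    {N P : Density 𝕜 d ε η ≃ₐ[𝕜] Density 𝕜 d ε η} (h : IsMixed Q N P) :
    integral (P (backgroundAction R)) = integral (N (backgroundAction R)) := by
  let u : Var ι G → Density 𝕜 d ε η := fun v => match v with
    | .field a => leftFun (.source a) Q
    | .source _ => 0
  let u' : Var ι G → Density 𝕜 d ε η := fun v => match v with
    | .field _ => 0
    | .source a => leftFun (.field a) Q
  have hD : IsEvolutionary 0 (vectorField u) := by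
    refine isEvolutionary_vectorField fun v => ?_
    cases v with
    | field a =>
      have := hQ1.leftFun (.source a)
      rw [Var.parity, add_assoc, zmod2_add_self] at this
      exact this
    | source a => exact hasParity_zero _
  have hD' : IsEvolutionary 0 (vectorField u') := by
    refine isEvolutionary_vectorField fun v => ?_
    cases v with
    | field a => exact hasParity_zero _
    | source a =>
      have := hQ1.leftFun (.field a)
      rw [add_zero]
      exact this
  have e1 : ∀ a, vectorField u (fld a) = leftFun (.source a) Q := fun a => vectorField_var _ _
  have e2 : ∀ a, vectorField u (src a) = 0 := fun a => vectorField_var _ _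
  have e3 : ∀ a, vectorField u' (fld a) = 0 := fun a => vectorField_var _ _
  have e4 : ∀ a, vectorField u' (src a) = leftFun (.field a) Q := fun a => vectorField_var _ _
  have hP : backgroundAction R ∈ affineDensities P.toLinearMap (vectorField u) := by
    refine neg_mem (sumLabels_induction (P := (· ∈ affineDensities _ _)) (zero_mem _)
      (fun _ _ => add_mem) fun a => ?_)
    refine mul_mem_affineDensities h.right.isSubstitution hD ?_ (h.right_src a) (e2 a)
    refine background_mem_affineDensities h.right.isSubstitution hD (fun a => ?_) (fun b hb => ?_)
      R a
    · rw [mem_affineDensities, e1]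
      exact h.right_fld a
    · rw [e1]
      exact leftFun_eq_zero_of_not_isQuantum hQ (v := .source b) fun h => h hb
  have hN : backgroundAction R ∈ affineDensities N.toLinearMap (vectorField u') := by
    refine neg_mem (sumLabels_induction (P := (· ∈ affineDensities _ _)) (zero_mem _)
      (fun _ _ => add_mem) fun a => ?_)
    -- The source is put first, because the product rule for affine densities requires the unshifted
    -- factor on the right.
    have hc : src a * R.background a ∈ affineDensities N.toLinearMap (vectorField u') := by
      have h0 : vectorField u' (R.background a) = 0 := by
        -- The identity substitution also fixes all fields, so its affine expansion reads x = x +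
        -- D'x, which forces D'x = 0.
        have := background_mem_affineDensities .id hD' (fun a => by
          rw [mem_affineDensities, e3, add_zero]; rfl) (fun b _ => e3 b) R a
        rw [mem_affineDensities] at this
        exact left_eq_add.1 this
      refine mul_mem_affineDensities h.left.isSubstitution hD' ?_ ?_ h0
      · rw [mem_affineDensities, e4]
        exact h.left_src a
      · have := background_mem_affineDensities h.left.isSubstitution hD' (fun a => by
          rw [mem_affineDensities, e3, add_zero]; exact h.left_fld a) (fun b _ => e3 b) R a
        rw [mem_affineDensities, h0, add_zero] at this
        exact this
    rw [((hasParity_background R a).mul_comm (hasParity_var (.source a)))]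
    exact Submodule.smul_mem _ _ hc
  have e5 := ((hD.sub hD').integral_eq (backgroundAction R)).symm
  simp only [LinearMap.sub_apply, e1, e2, e3, e4, sub_zero, zero_sub] at e5
  rw [← sub_eq_zero, ← map_sub]
  have e6 : P (backgroundAction R) - N (backgroundAction R) =
      vectorField u (backgroundAction R) - vectorField u' (backgroundAction R) := by
    have h1 := mem_affineDensities.1 hP
    have h2 := mem_affineDensities.1 hN
    rw [AlgEquiv.toLinearMap_apply] at h1 h2
    rw [h1, h2]
    abel
  rw [e6, ← e5, ← hR, antibracket_eq (hasParity_backgroundAction R), bracketDensity]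
  congr 2
  funext a
  have h1 := ((hasParity_backgroundAction R).leftFun (.field a)).mul_comm (hQ1.leftFun (.source a))
  have h2 := ((hasParity_backgroundAction R).leftFun (.source a)).mul_comm (hQ1.leftFun (.field a))
  have hs : sgn 𝕜 ((Var.parity ε η (.field a) + 0) * (Var.parity ε η (.source a) + 1)) =
      sgn 𝕜 (a.parity ε η) := by
    simp only [Var.parity, add_zero, add_assoc, zmod2_add_self, zmod2_mul_self]
  have hs' : sgn 𝕜 ((Var.parity ε η (.source a) + 0) * (Var.parity ε η (.field a) + 1)) =
      -sgn 𝕜 (a.parity ε η) := by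
    simp only [Var.parity, add_zero, zmod2_mul_self, sgn_add, sgn_one, mul_neg_one]
  rw [h1, h2, hs, hs', smul_add, smul_smul, smul_smul, mul_neg, sgn_mul_self, one_smul, neg_smul,
    one_smul, density_neg_mul]

end Background

end

end BV

theorem mainTheorem6 {ι G : Type*} [Fintype ι] [Fintype G] {𝕜 : Type*} [Field 𝕜] [CharZero 𝕜]
    {d : ℕ} {ε : ι → ZMod 2} {η : G → ZMod 2}
    (R : BV.GaugeTransformations 𝕜 d ε η)
    (Shat : BV.Density 𝕜 d ε η) (hShat_even : BV.HasParity 0 Shat)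
    (hShat : BV.IndependentOfBgGhostsAndSources Shat)
    (Q : BV.Density 𝕜 d ε η) (hQ_odd : BV.HasParity 1 Q)
    (hQ : BV.IndependentOfBgGhostsAndSources Q)
    (hQ_inv : BV.antibracket (BV.backgroundAction R) Q = 0)
    (T : BV.Density 𝕜 d ε η ≃ₐ[𝕜] BV.Density 𝕜 d ε η)
    (hT : BV.IsGeneratedBy (BV.generating Q) T) :
    (BV.MasterEquations Shat (BV.backgroundAction R) →
      BV.MasterEquations (T.symm Shat) (T.symm (BV.backgroundAction R))) ∧
    BV.IndependentOfBgGhostsAndSources (T.symm Shat) ∧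
    BV.integral (T.symm (BV.backgroundAction R)) = BV.integral (BV.backgroundAction R) ∧
    (∀ i, T (BV.fld (.bgPhys i)) = BV.fld (.bgPhys i)) ∧
    (∀ I, T (BV.fld (.bgGhost I)) = BV.fld (.bgGhost I)) ∧
    (∀ I, T (BV.src (.bgGhost I)) = BV.src (.bgGhost I)) := by
  obtain ⟨N, P, h, hP⟩ := hT.exists_isMixed
  have hT1 := hT.1
  -- δQ/δK̲ = 0, so P and N agree on background fields, and N can be cancelled from P = N T.
  have hfld : ∀ b : BV.Label ι G, b.IsBackground → T (BV.fld b) = BV.fld b := by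
    intro b hb
    apply N.injective
    rw [← hP, h.right_fld, h.left_fld,
      BV.leftFun_eq_zero_of_not_isQuantum hQ (v := .source b) fun h => h hb, add_zero]
  refine ⟨fun hM => ?_, BV.independent_symm hQ hT1 h hP hShat, ?_, fun i => hfld _ trivial,
    fun I => hfld _ trivial, fun I => ?_⟩
  · have key : ∀ {f g : BV.Density 𝕜 d ε η}, BV.HasParity 0 f → BV.HasParity 0 g →
        BV.antibracket f g = 0 → BV.antibracket (T.symm f) (T.symm g) = 0 := fun hf hg =>
      h.antibracket_eq_zero hQ_odd hf hg (hT1.symm.hasParity hf) (hT1.symm.hasParity hg)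
        (by rw [hP, AlgEquiv.apply_symm_apply]) (by rw [hP, AlgEquiv.apply_symm_apply])
    have hB := BV.hasParity_backgroundAction R
    exact ⟨key hShat_even hShat_even hM.1, key hShat_even hB hM.2.1, key hB hB hM.2.2⟩
  -- N⁻¹ turns the equality of P S̄ and N S̄ modulo total derivatives into that of T S̄ and S̄; T⁻¹
  -- then gives the claim.
  · have h1 := h.left.symm.integral_congr (BV.integral_backgroundAction R hQ_odd hQ hQ_inv h)
    rw [hP, AlgEquiv.symm_apply_apply, AlgEquiv.symm_apply_apply] at h1
    have h2 := hT1.symm.integral_congr h1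
    rw [AlgEquiv.symm_apply_apply] at h2
    exact h2.symm
  -- Here the shift of the source by N is δQ/δC̲ = 0.
  · apply N.injective
    rw [← hP, h.right_src, h.left_src, BV.leftFun_eq_zero_of_not_isQuantum hQ
      (v := .field (.bgGhost I)) fun h => h, add_zero]
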